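/- Let $k$ be a field of characteristic zero. A \emph{dendriform-Nijenhuis algebra} is a $k$-vector space with nine bilinear operations $\nearrow,\searrow,\swarrow,\nwarrow,\uparrow,\downarrow,\tilde\prec,\tilde\succ,\tilde\bullet$ such that, writing $$\triangleleft=\nwarrow+\swarrow+\tilde\prec,\quad \triangleright=\nearrow+\searrow+\tilde\succ,\quad \bar\bullet=\uparrow+\downarrow+\tilde\bullet,$$ $$\wedge=\nwarrow+\nearrow+\uparrow,\quad \vee=\searrow+\swarrow+\downarrow,\quad \tilde\star=\tilde\prec+\tilde\succ+\tilde\bullet,$$ and $\bar\star$ for the sum of the nine operations, the following 28 relations hold for all $x,y,z$: $$\begin{array}{lll} (x\nwarrow y)\nwarrow z=x\nwarrow(y\bar\star z), & (x\nearrow y)\nwarrow z=x\nearrow(y\triangleleft z), & (x\wedge y)\nearrow z=x\nearrow(y\triangleright z),\\ (x\swarrow y)\nwarrow z=x\swarrow(y\wedge z), & (x\searrow y)\nwarrow z=x\searrow(y\nwarrow z), & (x\vee y)\nearrow z=x\searrow(y\nearrow z),\\ (x\triangleleft y)\swarrow z=x\swarrow(y\vee z), & (x\triangleright y)\swarrow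 z=x\searrow(y\swarrow z), & (x\bar\star y)\searrow z=x\searrow(y\searrow z),\\ (x\swarrow y)\tilde\prec z=x\swarrow(y\tilde\star z), & (x\searrow y)\tilde\prec z=x\searrow(y\tilde\prec z), & (x\vee y)\tilde\succ z=x\searrow(y\tilde\succ z),\\ (x\nwarrow y)\tilde\prec z=x\tilde\prec(y\vee z), & (x\nearrow y)\tilde\prec z=x\tilde\succ(y\swarrow z), & (x\wedge y)\tilde\succ z=x\tilde\succ(y\searrow z),\\ (x\tilde\prec y)\nwarrow z=x\tilde\prec(y\wedge z), & (x\tilde\succ y)\nwarrow z=x\tilde\succ(y\nwarrow z), & (x\tilde\star y)\nearrow z=x\tilde\succ(y\nearrow z),\\ (x\tilde\prec y)\tilde\prec z=x\tilde\prec(y\tilde\star z), & (x\tilde\succ y)\tilde\prec z=x\tilde\succ(y\tilde\prec z), & (x\tilde\star y)\tilde\succ z=x\tilde\succ(y\tilde\succ z), \end{array}$$ $$\begin{array}{l} (x\wedge y)\uparrow z+(x\uparrow y)\nwarrow z=x\nearrow(y\bar\bullet z)+x\uparrow(y\bar\star z),\\ (x\vee y)\uparrow z+(x\downarrow y)\nwarrow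 z=x\searrow(y\uparrow z)+x\downarrow(y\wedge z),\\ (x\bar\star y)\downarrow z+(x\bar\bullet y)\swarrow z=x\searrow(y\downarrow z)+x\downarrow(y\vee z),\\ (x\vee y)\tilde\bullet z+(x\downarrow y)\tilde\prec z=x\searrow(y\tilde\bullet z)+x\downarrow(y\tilde\star z),\\ (x\wedge y)\tilde\bullet z+(x\uparrow y)\tilde\prec z=x\tilde\succ(y\downarrow z)+x\tilde\bullet(y\vee z),\\ (x\tilde\star y)\uparrow z+(x\tilde\bullet y)\nwarrow z=x\tilde\succ(y\uparrow z)+x\tilde\bullet(y\wedge z),\\ (x\tilde\star y)\tilde\bullet z+(x\tilde\bullet y)\tilde\prec z=x\tilde\succ(y\tilde\bullet z)+x\tilde\bullet(y\tilde\star z). \end{array}$$ (Then $\bar\star$ is associative.) It is \emph{commutative} if $x\searrow y=y\nwarrow x$, $x\nearrow y=y\swarrow x$, $x\uparrow y=y\downarrow x$, $x\tilde\succ y=y\tilde\prec x$ and $x\tilde\bullet y=y\tilde\bullet x$ for all $x,y$. The free (commutative) dendriform-Nijenhuis algebra on a vector space $V$ is the one, equipped with a linear map from $V$, that has the usual universal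 property for linear maps from $V$ to (commutative) dendriform-Nijenhuis algebras. For a dendriform-Nijenhuis algebra $A$ let $A_+=k1\oplus A$, a unital associative algebra for the product $\bar\star$ extended by $x\,\bar\star\,1=x=1\,\bar\star\,x$. The \emph{unit action} is: $x\nwarrow1=x$, $1\nwarrow x=0$, $1\searrow x=x$, $x\searrow1=0$, and $x\diamond1=0=1\diamond x$ for the other seven operations ($x\in A$). For dendriform-Nijenhuis algebras $A,B$ let $A\boxtimes B=A\otimes k1\,\oplus\,k1\otimes B\,\oplus\,A\otimes B\subset A_+\otimes B_+$, with, for each of the nine operations $\diamond$, $$(a\otimes b)\diamond(a'\otimes b')=(a\,\bar\star\,a')\otimes(b\diamond b')\ \text{ if } b\in B \text{ or } b'\in B,\qquad (a\otimes1)\diamond(a'\otimes1)=(a\diamond a')\otimes1 .$$ A bialgebra $H$ is \emph{connected} if $H=\bigcup_rF_r$ for the increasing filtration $F_0=k1$, $F_r=\{x:\Delta(x)-1\otimes x-x\otimes1\in F_{r-1}\otimes F_{r-1}\}$ for $r\ge1$. \textbf{Statement.} (1) The unit action is coherent: for all dendriform-Nijenhuis algebras $A,B$, the space $A\boxtimes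 B$ with these operations is a dendriform-Nijenhuis algebra, and it is commutative if $A$ and $B$ are. (2) Let $F$ be the free dendriform-Nijenhuis algebra $\mathcal{DN}(V)$ on a $k$-vector space $V$. Then the unital algebra $(F_+,\bar\star,1)$ carries a connected Hopf algebra structure. Its counit is the projection $F_+\to k1$; its coproduct $\Delta$ satisfies $\Delta(v)=1\otimes v+v\otimes1$ for $v\in V$, maps $F$ into $F\boxtimes F$, and $\Delta(x\diamond y)=\Delta(x)\diamond\Delta(y)$ for all $x,y\in F$ and each of the nine operations $\diamond$. (3) The same holds when $F$ is the free commutative dendriform-Nijenhuis algebra on $V$. -/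

import Mathlib

open scoped TensorProduct

universe u v w

/-- The nine operation symbols of a dendriform-Nijenhuis algebra:
`ne` is `↗`, `se` is `↘`, `sw` is `↙`, `nw` is `↖`, `up` is `↑`, `dn` is `↓`, and
`pre`, `suc`, `bul` are the tilded versions of `≺`, `≻`, `•`. -/
inductive DNOp : Type
  | ne | se | sw | nw | up | dn | pre | suc | bul

/-- Nine bilinear operations on a `k`-module. -/
abbrev DNOps (k : Type u) (A : Type v) [Field k] [AddCommGroup A] [Module k A] :=
  DNOp → A →ₗ[k] A →ₗ[k] A

namespace DNOps

variable {k : Type u} {A : Type v} [Field k] [AddCommGroup A] [Module k A] (o : DNOps k A)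

/-- `x ◁ y` -/
def lt (x y : A) : A := o .nw x y + o .sw x y + o .pre x y

/-- `x ▷ y` -/
def rt (x y : A) : A := o .ne x y + o .se x y + o .suc x y

/-- `x •̄ y` (barred bullet) -/
def bb (x y : A) : A := o .up x y + o .dn x y + o .bul x y

/-- `x ∧ y` -/
def we (x y : A) : A := o .nw x y + o .ne x y + o .up x y

/-- `x ∨ y` -/
def ve (x y : A) : A := o .se x y + o .sw x y + o .dn x y

/-- `x ⋆̃ y` (tilded star) -/
def ts (x y : A) : A := o .pre x y + o .suc x y + o .bul x y

/-- `x ⋆̄ y` (barred star): the sum of the nine operations. -/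
def star (x y : A) : A :=
  o .ne x y + o .se x y + o .sw x y + o .nw x y + o .up x y + o .dn x y
    + o .pre x y + o .suc x y + o .bul x y

end DNOps

/-- The 28 relations of a dendriform-Nijenhuis algebra. -/
structure IsDendNij {k : Type u} {A : Type v} [Field k] [AddCommGroup A] [Module k A]
    (o : DNOps k A) : Prop where
  m11 : ∀ x y z, o .nw (o .nw x y) z = o .nw x (o.star y z)
  m12 : ∀ x y z, o .nw (o .ne x y) z = o .ne x (o.lt y z)
  m13 : ∀ x y z, o .ne (o.we x y) z = o .ne x (o.rt y z)
  m21 : ∀ x y z, o .nw (o .sw x y) z = o .sw x (o.we y z)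
  m22 : ∀ x y z, o .nw (o .se x y) z = o .se x (o .nw y z)
  m23 : ∀ x y z, o .ne (o.ve x y) z = o .se x (o .ne y z)
  m31 : ∀ x y z, o .sw (o.lt x y) z = o .sw x (o.ve y z)
  m32 : ∀ x y z, o .sw (o.rt x y) z = o .se x (o .sw y z)
  m33 : ∀ x y z, o .se (o.star x y) z = o .se x (o .se y z)
  m41 : ∀ x y z, o .pre (o .sw x y) z = o .sw x (o.ts y z)
  m42 : ∀ x y z, o .pre (o .se x y) z = o .se x (o .pre y z)
  m43 : ∀ x y z, o .suc (o.ve x y) z = o .se x (o .suc y z)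
  m51 : ∀ x y z, o .pre (o .nw x y) z = o .pre x (o.ve y z)
  m52 : ∀ x y z, o .pre (o .ne x y) z = o .suc x (o .sw y z)
  m53 : ∀ x y z, o .suc (o.we x y) z = o .suc x (o .se y z)
  m61 : ∀ x y z, o .nw (o .pre x y) z = o .pre x (o.we y z)
  m62 : ∀ x y z, o .nw (o .suc x y) z = o .suc x (o .nw y z)
  m63 : ∀ x y z, o .ne (o.ts x y) z = o .suc x (o .ne y z)
  m71 : ∀ x y z, o .pre (o .pre x y) z = o .pre x (o.ts y z)
  m72 : ∀ x y z, o .pre (o .suc x y) z = o .suc x (o .pre y z)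
  m73 : ∀ x y z, o .suc (o.ts x y) z = o .suc x (o .suc y z)
  n1 : ∀ x y z, o .up (o.we x y) z + o .nw (o .up x y) z
    = o .ne x (o.bb y z) + o .up x (o.star y z)
  n2 : ∀ x y z, o .up (o.ve x y) z + o .nw (o .dn x y) z
    = o .se x (o .up y z) + o .dn x (o.we y z)
  n3 : ∀ x y z, o .dn (o.star x y) z + o .sw (o.bb x y) z
    = o .se x (o .dn y z) + o .dn x (o.ve y z)
  n4 : ∀ x y z, o .bul (o.ve x y) z + o .pre (o .dn x y) z
    = o .se x (o .bul y z) + o .dn x (o.ts y z)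
  n5 : ∀ x y z, o .bul (o.we x y) z + o .pre (o .up x y) z
    = o .suc x (o .dn y z) + o .bul x (o.ve y z)
  n6 : ∀ x y z, o .up (o.ts x y) z + o .nw (o .bul x y) z
    = o .suc x (o .up y z) + o .bul x (o.we y z)
  n7 : ∀ x y z, o .bul (o.ts x y) z + o .pre (o .bul x y) z
    = o .suc x (o .bul y z) + o .bul x (o.ts y z)

/-- The symbol `c'` such that `x c^op y = y c' x`. -/
def DNOp.opp : DNOp → DNOp
  | .se => .nw
  | .ne => .sw
  | .nw => .se
  | .sw => .ne
  | .up => .dn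
  | .dn => .up
  | .suc => .pre
  | .bul => .bul
  | .pre => .suc

/-- The structure coincides with its opposite. -/
def IsCommDN {k : Type u} {A : Type v} [Field k] [AddCommGroup A] [Module k A]
    (o : DNOps k A) : Prop :=
  ∀ c x y, o c x y = o c.opp y x

/-- A linear map respecting the nine operations. -/
def IsDNHom {k : Type u} {A : Type v} {B : Type w} [Field k] [AddCommGroup A] [Module k A]
    [AddCommGroup B] [Module k B] (oA : DNOps k A) (oB : DNOps k B) (g : A →ₗ[k] B) : Prop :=
  ∀ c x y, g (oA c x y) = oB c (g x) (g y)

/-- `(F, o)` with `i : V → F` is a free dendriform-Nijenhuis algebra on the vector space `V`. -/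
structure IsFreeDN {k : Type u} {V : Type v} {F : Type (max u v)} [Field k] [AddCommGroup V]
    [Module k V] [AddCommGroup F] [Module k F] (o : DNOps k F) (i : V →ₗ[k] F) : Prop where
  isDendNij : IsDendNij o
  existsUnique_lift : ∀ (A : Type (max u v)) [AddCommGroup A] [Module k A] (oA : DNOps k A),
    IsDendNij oA → ∀ f : V →ₗ[k] A, ∃! g : F →ₗ[k] A, IsDNHom o oA g ∧ g ∘ₗ i = f

/-- `(F, o)` with `i : V → F` is a free commutative dendriform-Nijenhuis algebra on the
vector space `V`. -/
structure IsFreeCommDN {k : Type u} {V : Type v} {F : Type (max u v)} [Field k] [AddCommGroup V]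
    [Module k V] [AddCommGroup F] [Module k F] (o : DNOps k F) (i : V →ₗ[k] F) : Prop where
  isDendNij : IsDendNij o
  isComm : IsCommDN o
  existsUnique_lift : ∀ (A : Type (max u v)) [AddCommGroup A] [Module k A] (oA : DNOps k A),
    IsDendNij oA → IsCommDN oA →
      ∀ f : V →ₗ[k] A, ∃! g : F →ₗ[k] A, IsDNHom o oA g ∧ g ∘ₗ i = f

/-! ### Existence of free algebras -/

section Hom

variable {k : Type u} {A : Type v} {B : Type w} [Field k] [AddCommGroup A] [Module k A]
  [AddCommGroup B] [Module k B] {oA : DNOps k A} {oB : DNOps k B} {g : A →ₗ[k] B}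

theorem IsDNHom.map_lt (h : IsDNHom oA oB g) (x y : A) :
    g (oA.lt x y) = oB.lt (g x) (g y) := by
  simp only [DNOps.lt, map_add, h _ x y]

theorem IsDNHom.map_rt (h : IsDNHom oA oB g) (x y : A) :
    g (oA.rt x y) = oB.rt (g x) (g y) := by
  simp only [DNOps.rt, map_add, h _ x y]

theorem IsDNHom.map_bb (h : IsDNHom oA oB g) (x y : A) :
    g (oA.bb x y) = oB.bb (g x) (g y) := by
  simp only [DNOps.bb, map_add, h _ x y]

theorem IsDNHom.map_we (h : IsDNHom oA oB g) (x y : A) :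
    g (oA.we x y) = oB.we (g x) (g y) := by
  simp only [DNOps.we, map_add, h _ x y]

theorem IsDNHom.map_ve (h : IsDNHom oA oB g) (x y : A) :
    g (oA.ve x y) = oB.ve (g x) (g y) := by
  simp only [DNOps.ve, map_add, h _ x y]

theorem IsDNHom.map_ts (h : IsDNHom oA oB g) (x y : A) :
    g (oA.ts x y) = oB.ts (g x) (g y) := by
  simp only [DNOps.ts, map_add, h _ x y]

theorem IsDNHom.map_star (h : IsDNHom oA oB g) (x y : A) :
    g (oA.star x y) = oB.star (g x) (g y) := by
  simp only [DNOps.star, map_add, h _ x y]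

end Hom

theorem IsDendNij.of_joint {k : Type u} {F : Type v} [Field k] [AddCommGroup F] [Module k F]
    {o : DNOps k F} (e : ∀ x y : F, (∀ (A : Type w) [AddCommGroup A] [Module k A]
      (oA : DNOps k A) (g : F →ₗ[k] A), IsDendNij oA → IsDNHom o oA g → g x = g y) → x = y) :
    IsDendNij o := by
  constructor <;> intro x y z <;> refine e _ _ fun A _ _ oA g h H => ?_ <;>
    simp only [map_add, H.map_lt, H.map_rt, H.map_bb, H.map_we, H.map_ve, H.map_ts, H.map_star,
      H _ _ _]
  · exact h.m11 _ _ _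
  · exact h.m12 _ _ _
  · exact h.m13 _ _ _
  · exact h.m21 _ _ _
  · exact h.m22 _ _ _
  · exact h.m23 _ _ _
  · exact h.m31 _ _ _
  · exact h.m32 _ _ _
  · exact h.m33 _ _ _
  · exact h.m41 _ _ _
  · exact h.m42 _ _ _
  · exact h.m43 _ _ _
  · exact h.m51 _ _ _
  · exact h.m52 _ _ _
  · exact h.m53 _ _ _
  · exact h.m61 _ _ _
  · exact h.m62 _ _ _
  · exact h.m63 _ _ _
  · exact h.m71 _ _ _
  · exact h.m72 _ _ _
  · exact h.m73 _ _ _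
  · exact h.n1 _ _ _
  · exact h.n2 _ _ _
  · exact h.n3 _ _ _
  · exact h.n4 _ _ _
  · exact h.n5 _ _ _
  · exact h.n6 _ _ _
  · exact h.n7 _ _ _

section Free

/-- Planar binary trees with internal vertices decorated by operations and leaves by `V`. -/
inductive DNTree (V : Type v) : Type v
  | leaf : V → DNTree V
  | node : DNOp → DNTree V → DNTree V → DNTree V

variable {k : Type u} {V : Type v} [Field k]

/-- Evaluation of a tree in an algebra. -/
def DNTree.eval {A : Type w} [AddCommGroup A] [Module k A] (oA : DNOps k A) (f : V → A) :
    DNTree V → A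
  | .leaf v => f v
  | .node c s t => oA c (s.eval oA f) (t.eval oA f)

/-- Linear combinations of trees. -/
abbrev DNPre (k : Type u) (V : Type v) [Field k] := DNTree V →₀ k

namespace DNPre

/-- Grafting of trees, extended bilinearly. -/
noncomputable def op (k : Type u) (V : Type v) [Field k] : DNOps k (DNPre k V) := fun c =>
  Finsupp.linearCombination k fun s =>
    Finsupp.linearCombination k fun t => Finsupp.single (DNTree.node c s t) (1 : k)

/-- Evaluation, extended linearly. -/
noncomputable def eval {A : Type w} [AddCommGroup A] [Module k A] (oA : DNOps k A) (f : V → A) :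
    DNPre k V →ₗ[k] A := Finsupp.linearCombination k (DNTree.eval oA f)

theorem op_single (c : DNOp) (s t : DNTree V) :
    op k V c (Finsupp.single s 1) (Finsupp.single t 1) = Finsupp.single (.node c s t) 1 := by
  rw [op, Finsupp.linearCombination_single, one_smul, Finsupp.linearCombination_single, one_smul]

theorem eval_single {A : Type w} [AddCommGroup A] [Module k A] (oA : DNOps k A) (f : V → A)
    (t : DNTree V) : eval oA f (Finsupp.single t 1) = t.eval oA f := by
  rw [eval, Finsupp.linearCombination_single, one_smul]

theorem eval_op {A : Type w} [AddCommGroup A] [Module k A] (oA : DNOps k A) (f : V → A)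
    (c : DNOp) (x y : DNPre k V) :
    eval oA f (op k V c x y) = oA c (eval oA f x) (eval oA f y) := by
  induction x using Finsupp.induction_linear with
  | zero => simp
  | add x x' hx hx' => simp [hx, hx']
  | single s r =>
    induction y using Finsupp.induction_linear with
    | zero => simp
    | add y y' hy hy' => simp [hy, hy']
    | single t r' =>
      rw [← Finsupp.smul_single_one s, ← Finsupp.smul_single_one t]
      simp only [map_smul, LinearMap.smul_apply, op_single, eval_single, DNTree.eval]

/-- The elements that vanish in every (commutative, if `b` holds) dendriform-Nijenhuis algebra. -/
def rel (k : Type u) (V : Type v) [Field k] [AddCommGroup V] [Module k V] (b : Prop) :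
    Submodule k (DNPre k V) where
  carrier := {x | ∀ (A : Type (max u v)) [AddCommGroup A] [Module k A] (oA : DNOps k A)
    (f : V →ₗ[k] A), IsDendNij oA → (b → IsCommDN oA) → eval oA f x = 0}
  add_mem' hx hy A _ _ oA f h h' := by rw [map_add, hx A oA f h h', hy A oA f h h', add_zero]
  zero_mem' A _ _ oA f h h' := map_zero _
  smul_mem' r x hx A _ _ oA f h h' := by rw [map_smul, hx A oA f h h', smul_zero]

end DNPre

/-- The free (commutative, if `b` holds) dendriform-Nijenhuis algebra. -/
abbrev FreeDN (k : Type u) (V : Type v) [Field k] [AddCommGroup V] [Module k V] (b : Prop) :=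
  DNPre k V ⧸ DNPre.rel k V b

namespace FreeDN

open DNPre

variable [AddCommGroup V] [Module k V] (b : Prop)

/-- The operations of the free algebra. -/
noncomputable def ops (k : Type u) (V : Type v) [Field k] [AddCommGroup V] [Module k V]
    (b : Prop) : DNOps k (FreeDN k V b) := fun c =>
  (rel k V b).liftQ
    (LinearMap.flip ((rel k V b).liftQ ((op k V c).compr₂ (rel k V b).mkQ).flip
      (fun y hy => by
        refine LinearMap.ext fun x => ?_
        refine (Submodule.Quotient.mk_eq_zero _).2 ?_
        intro A _ _ oA f h h'
        rw [eval_op, hy A oA f h h', map_zero])))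
    (fun x hx => by
      refine LinearMap.ext fun y => ?_
      obtain ⟨y, rfl⟩ := (rel k V b).mkQ_surjective y
      refine (Submodule.Quotient.mk_eq_zero _).2 ?_
      intro A _ _ oA f h h'
      rw [eval_op, hx A oA f h h', map_zero, LinearMap.zero_apply])

theorem ops_mk (c : DNOp) (x y : DNPre k V) :
    ops k V b c ((rel k V b).mkQ x) ((rel k V b).mkQ y) = (rel k V b).mkQ (op k V c x y) := rfl

variable {b}

/-- The morphism to an algebra `A` induced by a linear map `V → A`. -/
noncomputable def lift {A : Type (max u v)} [AddCommGroup A] [Module k A] {oA : DNOps k A}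
    (h : IsDendNij oA) (h' : b → IsCommDN oA) (f : V →ₗ[k] A) : FreeDN k V b →ₗ[k] A :=
  (rel k V b).liftQ (eval oA f) (fun _ hx => hx A oA f h h')

theorem lift_ops {A : Type (max u v)} [AddCommGroup A] [Module k A] {oA : DNOps k A}
    (h : IsDendNij oA) (h' : b → IsCommDN oA) (f : V →ₗ[k] A) (c : DNOp) (x y : FreeDN k V b) :
    lift h h' f (ops k V b c x y) = oA c (lift h h' f x) (lift h h' f y) := by
  obtain ⟨x, rfl⟩ := (rel k V b).mkQ_surjective x
  obtain ⟨y, rfl⟩ := (rel k V b).mkQ_surjective y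
  exact eval_op oA f c x y

theorem ext_lift {x y : FreeDN k V b} (e : ∀ (A : Type (max u v)) [AddCommGroup A] [Module k A]
    (oA : DNOps k A) (f : V →ₗ[k] A) (h : IsDendNij oA) (h' : b → IsCommDN oA),
    lift h h' f x = lift h h' f y) : x = y := by
  obtain ⟨x, rfl⟩ := (rel k V b).mkQ_surjective x
  obtain ⟨y, rfl⟩ := (rel k V b).mkQ_surjective y
  refine (Submodule.Quotient.eq _).2 fun A _ _ oA f h h' => ?_
  rw [map_sub, sub_eq_zero]
  exact e A oA f h h'

variable (k V b)

/-- The inclusion of the generators. -/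
noncomputable def gen : V →ₗ[k] FreeDN k V b where
  toFun v := (rel k V b).mkQ (Finsupp.single (DNTree.leaf v) 1)
  map_add' v v' := ext_lift fun A _ _ oA f h h' => by simp [lift, eval, DNTree.eval]
  map_smul' r v := ext_lift fun A _ _ oA f h h' => by simp [lift, eval, DNTree.eval]

theorem isDendNij : IsDendNij (ops k V b) := by
  refine IsDendNij.of_joint fun x y e => ext_lift fun A _ _ oA f h h' => ?_
  exact e A oA (lift h h' f) h (lift_ops h h' f)

theorem isComm (hb : b) : IsCommDN (ops k V b) := fun c x y =>
  ext_lift fun A _ _ oA f h h' => by rw [lift_ops, lift_ops]; exact h' hb c _ _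

theorem existsUnique_lift {A : Type (max u v)} [AddCommGroup A] [Module k A] {oA : DNOps k A}
    (h : IsDendNij oA) (h' : b → IsCommDN oA) (f : V →ₗ[k] A) :
    ∃! g : FreeDN k V b →ₗ[k] A, IsDNHom (ops k V b) oA g ∧ g ∘ₗ gen k V b = f := by
  refine ⟨lift h h' f, ⟨lift_ops h h' f, ?_⟩, fun g hg => ?_⟩
  · ext v
    simp [lift, gen, eval, DNTree.eval]
  · have key : ∀ t : DNTree V,
        g ((rel k V b).mkQ (Finsupp.single t 1)) = DNTree.eval oA f t := by
      intro t
      induction t with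
      | leaf v => exact LinearMap.congr_fun hg.2 v
      | node c s t hs ht =>
        rw [DNTree.eval, ← hs, ← ht, ← hg.1, ops_mk, op_single]
    ext t
    simpa [lift, eval] using key t

end FreeDN

theorem FreeDN.isFreeDN (k : Type u) (V : Type v) [Field k] [AddCommGroup V] [Module k V] :
    IsFreeDN (FreeDN.ops k V False) (FreeDN.gen k V False) :=
  ⟨FreeDN.isDendNij k V False,
    fun _ _ _ _ h f => FreeDN.existsUnique_lift k V False h (fun e => e.elim) f⟩

theorem FreeDN.isFreeCommDN (k : Type u) (V : Type v) [Field k] [AddCommGroup V] [Module k V] :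
    IsFreeCommDN (FreeDN.ops k V True) (FreeDN.gen k V True) :=
  ⟨FreeDN.isDendNij k V True, FreeDN.isComm k V True trivial,
    fun _ _ _ _ h h' f => FreeDN.existsUnique_lift k V True h (fun _ => h') f⟩

end Free

/-! ### The augmented algebra `k1 ⊕ A` -/

theorem IsDendNij.star_assoc {k : Type u} {A : Type v} [Field k] [AddCommGroup A] [Module k A]
    {o : DNOps k A} (h : IsDendNij o) (x y z : A) :
    o.star (o.star x y) z = o.star x (o.star y z) := by
  have e11 := h.m11 x y z
  have e12 := h.m12 x y z
  have e13 := h.m13 x y z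
  have e21 := h.m21 x y z
  have e22 := h.m22 x y z
  have e23 := h.m23 x y z
  have e31 := h.m31 x y z
  have e32 := h.m32 x y z
  have e33 := h.m33 x y z
  have e41 := h.m41 x y z
  have e42 := h.m42 x y z
  have e43 := h.m43 x y z
  have e51 := h.m51 x y z
  have e52 := h.m52 x y z
  have e53 := h.m53 x y z
  have e61 := h.m61 x y z
  have e62 := h.m62 x y z
  have e63 := h.m63 x y z
  have e71 := h.m71 x y z
  have e72 := h.m72 x y z
  have e73 := h.m73 x y z
  have d1 := h.n1 x y z
  have d2 := h.n2 x y z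
  have d3 := h.n3 x y z
  have d4 := h.n4 x y z
  have d5 := h.n5 x y z
  have d6 := h.n6 x y z
  have d7 := h.n7 x y z
  simp only [DNOps.star, DNOps.lt, DNOps.rt, DNOps.bb, DNOps.we, DNOps.ve, DNOps.ts, map_add,
    LinearMap.add_apply] at *
  linear_combination (norm := abel) e11 + e12 + e13 + e21 + e22 + e23 + e31 + e32 + e33 + e41 + e42
    + e43 + e51 + e52 + e53 + e61 + e62 + e63 + e71 + e72 + e73 + d1 + d2 + d3 + d4 + d5 + d6 + d7

/-- The vector space `A` with the associative (non-unital) product `⋆̄`. -/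
@[nolint unusedArguments]
def StarAlg {k : Type u} {A : Type v} [Field k] [AddCommGroup A] [Module k A]
    {o : DNOps k A} (_h : IsDendNij o) : Type v := A

namespace StarAlg

variable {k : Type u} {A : Type v} [Field k] [AddCommGroup A] [Module k A]
  {o : DNOps k A} (h : IsDendNij o)

instance : AddCommGroup (StarAlg h) := inferInstanceAs (AddCommGroup A)

instance : Module k (StarAlg h) := inferInstanceAs (Module k A)

/-- The identity map `A → StarAlg h`. -/
def of : A ≃ₗ[k] StarAlg h := LinearEquiv.refl k A

instance : NonUnitalRing (StarAlg h) where
  mul x y := of h (o.star ((of h).symm x) ((of h).symm y))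
  left_distrib x y z := by
    change of h (o.star ((of h).symm x) ((of h).symm (y + z)))
      = of h (o.star ((of h).symm x) ((of h).symm y))
        + of h (o.star ((of h).symm x) ((of h).symm z))
    rw [← map_add]; congr 1; simp only [DNOps.star, map_add]; abel
  right_distrib x y z := by
    change of h (o.star ((of h).symm (x + y)) ((of h).symm z))
      = of h (o.star ((of h).symm x) ((of h).symm z))
        + of h (o.star ((of h).symm y) ((of h).symm z))
    rw [← map_add]; congr 1; simp only [DNOps.star, map_add, LinearMap.add_apply]; abel
  zero_mul x := by
    change of h (o.star ((of h).symm 0) ((of h).symm x)) = 0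
    simp [DNOps.star]
  mul_zero x := by
    change of h (o.star ((of h).symm x) ((of h).symm 0)) = 0
    simp [DNOps.star]
  mul_assoc x y z := h.star_assoc x y z

theorem of_mul_of (x y : A) : of h x * of h y = of h (o.star x y) := rfl

instance : IsScalarTower k (StarAlg h) (StarAlg h) where
  smul_assoc r x y := by
    change of h (o.star ((of h).symm (r • x)) ((of h).symm y))
      = r • of h (o.star ((of h).symm x) ((of h).symm y))
    simp [DNOps.star, smul_add]

instance : SMulCommClass k (StarAlg h) (StarAlg h) where
  smul_comm r x y := by
    change r • of h (o.star ((of h).symm x) ((of h).symm y))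
      = of h (o.star ((of h).symm x) ((of h).symm (r • y)))
    simp [DNOps.star, smul_add]

end StarAlg

/-- The augmented algebra `A₊ = k1 ⊕ A`, a unital associative algebra for the product `⋆̄`
extended by `x ⋆̄ 1 = x = 1 ⋆̄ x`. -/
abbrev Aug {k : Type u} {A : Type v} [Field k] [AddCommGroup A] [Module k A]
    {o : DNOps k A} (h : IsDendNij o) := Unitization k (StarAlg h)

namespace Aug

variable {k : Type u} {A : Type v} [Field k] [AddCommGroup A] [Module k A]
  {o : DNOps k A} (h : IsDendNij o)

/-- The inclusion `A → A₊`. -/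
def incl : A →ₗ[k] Aug h := Unitization.inrHom k k (StarAlg h) ∘ₗ (StarAlg.of h).toLinearMap

/-- The projection `A₊ → A`. -/
def proj : Aug h →ₗ[k] A := (StarAlg.of h).symm.toLinearMap ∘ₗ Unitization.sndHom k k (StarAlg h)

end Aug

/-! ### The unit action and the tensor product of two augmented algebras -/

/-- `x ↖ 1 = x`, and `x ⋄ 1 = 0` for the other operations. -/
def DNOp.rightUnit (k : Type u) [Field k] : DNOp → k
  | .nw => 1
  | _ => 0

/-- `1 ↘ x = x`, and `1 ⋄ x = 0` for the other operations. -/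
def DNOp.leftUnit (k : Type u) [Field k] : DNOp → k
  | .se => 1
  | _ => 0

section Tensor

variable {k : Type u} {A : Type v} {B : Type w} [Field k] [AddCommGroup A] [Module k A]
  [AddCommGroup B] [Module k B] {oA : DNOps k A} {oB : DNOps k B}

/-- The operations of `A` extended to `A₊` by the unit action. The expression `1 ⋄ 1` has no
meaning; it is given the value `0`, which never matters on `augTensor` below. -/
def extOp (hA : IsDendNij oA) (c : DNOp) : Aug hA →ₗ[k] Aug hA →ₗ[k] Aug hA :=
  LinearMap.mk₂ k
    (fun x y => Aug.incl hA (oA c (Aug.proj hA x) (Aug.proj hA y)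
      + (c.rightUnit k * y.fst) • Aug.proj hA x + (c.leftUnit k * x.fst) • Aug.proj hA y))
    (fun x x' y => by
      rw [← map_add]; congr 1
      simp only [map_add, LinearMap.add_apply, Unitization.fst_add]; module)
    (fun r x y => by
      rw [← map_smul (Aug.incl hA)]; congr 1
      simp only [map_smul, LinearMap.smul_apply, Unitization.fst_smul, smul_eq_mul]; module)
    (fun x y y' => by
      rw [← map_add]; congr 1
      simp only [map_add, Unitization.fst_add]; module)
    (fun r x y => by
      rw [← map_smul (Aug.incl hA)]; congr 1
      simp only [map_smul, Unitization.fst_smul, smul_eq_mul]; module)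

theorem extOp_incl_incl (hA : IsDendNij oA) (c : DNOp) (x y : A) :
    extOp hA c (Aug.incl hA x) (Aug.incl hA y) = Aug.incl hA (oA c x y) := by
  simp [extOp, Aug.incl, Aug.proj]

theorem extOp_incl_one (hA : IsDendNij oA) (c : DNOp) (x : A) :
    extOp hA c (Aug.incl hA x) 1 = c.rightUnit k • Aug.incl hA x := by
  simp [extOp, Aug.incl, Aug.proj]

theorem extOp_one_incl (hA : IsDendNij oA) (c : DNOp) (x : A) :
    extOp hA c 1 (Aug.incl hA x) = c.leftUnit k • Aug.incl hA x := by
  simp [extOp, Aug.incl, Aug.proj]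

theorem extOp_one_one (hA : IsDendNij oA) (c : DNOp) : extOp hA c 1 1 = 0 := by
  simp [extOp, Aug.incl, Aug.proj]

/-- The bilinear map `(b, b') ↦ ε(b) ε(b') 1` on `B₊`, where `ε` is the projection to `k`. -/
def unitPart (hB : IsDendNij oB) : Aug hB →ₗ[k] Aug hB →ₗ[k] Aug hB :=
  LinearMap.mk₂ k (fun x y => (x.fst * y.fst) • (1 : Aug hB))
    (fun x x' y => by simp only [Unitization.fst_add]; module)
    (fun r x y => by simp only [Unitization.fst_smul, smul_eq_mul]; module)
    (fun x y y' => by simp only [Unitization.fst_add]; module)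
    (fun r x y => by simp only [Unitization.fst_smul, smul_eq_mul]; module)

/-- The operations on `A₊ ⊗ B₊`:
`(a ⊗ b) ⋄ (a' ⊗ b') = (a ⋆̄ a') ⊗ (b ⋄ b')` if one of `b`, `b'` lies in `B`, and
`(a ⊗ 1) ⋄ (a' ⊗ 1) = (a ⋄ a') ⊗ 1` (see the three lemmas that follow). -/
noncomputable def tensorOp (hA : IsDendNij oA) (hB : IsDendNij oB) (c : DNOp) :
    Aug hA ⊗[k] Aug hB →ₗ[k] Aug hA ⊗[k] Aug hB →ₗ[k] Aug hA ⊗[k] Aug hB :=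
  TensorProduct.map₂ (LinearMap.mul k (Aug hA)) (extOp hB c)
    + TensorProduct.map₂ (extOp hA c) (unitPart hB)

theorem tensorOp_left (hA : IsDendNij oA) (hB : IsDendNij oB) (c : DNOp) (a a' : Aug hA) (b : B)
    (b' : Aug hB) : tensorOp hA hB c (a ⊗ₜ Aug.incl hB b) (a' ⊗ₜ b')
      = (a * a') ⊗ₜ extOp hB c (Aug.incl hB b) b' := by
  simp [tensorOp, unitPart, Aug.incl]

theorem tensorOp_right (hA : IsDendNij oA) (hB : IsDendNij oB) (c : DNOp) (a a' : Aug hA)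
    (b : Aug hB) (b' : B) : tensorOp hA hB c (a ⊗ₜ b) (a' ⊗ₜ Aug.incl hB b')
      = (a * a') ⊗ₜ extOp hB c b (Aug.incl hB b') := by
  simp [tensorOp, unitPart, Aug.incl]

theorem tensorOp_one_one (hA : IsDendNij oA) (hB : IsDendNij oB) (c : DNOp) (a a' : Aug hA) :
    tensorOp hA hB c (a ⊗ₜ 1) (a' ⊗ₜ 1) = extOp hA c a a' ⊗ₜ 1 := by
  simp [tensorOp, unitPart, extOp_one_one]

/-- The subspace `A ⊗ k1 ⊕ k1 ⊗ B ⊕ A ⊗ B` of `A₊ ⊗ B₊`. -/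
def augTensor (hA : IsDendNij oA) (hB : IsDendNij oB) : Submodule k (Aug hA ⊗[k] Aug hB) :=
  Submodule.span k
    ({t | ∃ a : A, t = Aug.incl hA a ⊗ₜ 1} ∪ {t | ∃ b : B, t = 1 ⊗ₜ Aug.incl hB b}
      ∪ {t | ∃ (a : A) (b : B), t = Aug.incl hA a ⊗ₜ Aug.incl hB b})

end Tensor

/-! ### Connected Hopf algebras -/

section Hopf

variable {k : Type u} {H : Type v} [Field k] [Ring H] [Algebra k H]

/-- The coproduct `Δ` and the counit `ε` make the algebra `H` a Hopf algebra. -/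
def IsHopf (Δ : H →ₐ[k] H ⊗[k] H) (ε : H →ₐ[k] k) : Prop :=
  ∃ h₁ h₂ h₃, ∃ S : HopfAlgebra k H, S.toBialgebra = Bialgebra.ofAlgHom Δ ε h₁ h₂ h₃

/-- `x ↦ Δ(x) - 1 ⊗ x - x ⊗ 1` -/
noncomputable def reducedComul (Δ : H →ₐ[k] H ⊗[k] H) : H →ₗ[k] H ⊗[k] H :=
  Δ.toLinearMap - TensorProduct.mk k H H 1 - (TensorProduct.mk k H H).flip 1

/-- `F₀ = k1` and `Fᵣ₊₁ = {x | Δ(x) - 1 ⊗ x - x ⊗ 1 ∈ Fᵣ ⊗ Fᵣ}`. -/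
noncomputable def connFiltration (Δ : H →ₐ[k] H ⊗[k] H) : ℕ → Submodule k H
  | 0 => Submodule.span k {1}
  | r + 1 => (LinearMap.range (TensorProduct.map (connFiltration Δ r).subtype
      (connFiltration Δ r).subtype)).comap (reducedComul Δ)

/-- `H` is the union of an increasing filtration `(Fᵣ)` as above. -/
def IsConnectedComul (Δ : H →ₐ[k] H ⊗[k] H) : Prop :=
  Monotone (connFiltration Δ) ∧ ∀ x, ∃ r, x ∈ connFiltration Δ r

end Hopf

/-- The augmented algebra `F₊` of a dendriform-Nijenhuis algebra `F` generated by `i : V → F`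
carries a connected Hopf algebra structure whose product is `⋆̄`, whose counit is the projection
onto `k1`, whose coproduct is a morphism of (augmented) dendriform-Nijenhuis algebras, and
for which the elements of `V` are primitive. -/
def HasConnectedHopf {k : Type u} {V : Type v} {F : Type w} [Field k] [AddCommGroup V]
    [Module k V] [AddCommGroup F] [Module k F] {o : DNOps k F} (h : IsDendNij o)
    (i : V →ₗ[k] F) : Prop :=
  ∃ (Δ : Aug h →ₐ[k] Aug h ⊗[k] Aug h) (ε : Aug h →ₐ[k] k),
    IsHopf Δ ε ∧ IsConnectedComul Δ ∧ (∀ x, ε x = x.fst) ∧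
    (∀ v, Δ (Aug.incl h (i v)) = 1 ⊗ₜ Aug.incl h (i v) + Aug.incl h (i v) ⊗ₜ 1) ∧
    (∀ x, Δ (Aug.incl h x) ∈ augTensor h h) ∧
    ∀ c x y, Δ (Aug.incl h (o c x y))
      = tensorOp h h c (Δ (Aug.incl h x)) (Δ (Aug.incl h y))

/-! On `A₊ ⊗ B₊` each operation has the form `μ ⊗ e + e ⊗ u`, where `μ` is the product `⋆̄`, `e` is
the operation extended by the unit action (`extOp`), and `u(b, b') = ε(b) ε(b') 1` (`unitPart`).
Most of the proof exploits this formula.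

Coherence. Both sides of a relation are trilinear, so it suffices to compare them on tensors `a ⊗ 1`
with `a` in `A`, and `a ⊗ b` with `a` in `A₊` and `b` in `B`. If all second legs are `1`, the
relation is that of `A`; if all lie in `B`, it is that of `B` tensored with a product in `A₊`. In
the mixed cases the unit action kills most terms, and what survives is a tautology or associativity
of `⋆̄` (`tensorOp_relations`).

Coproduct. Freeness extends `v ↦ 1 ⊗ v + v ⊗ 1` to a morphism `F → F ⊠ F`. The nine operations of `F
⊠ F` add up to the product of `F₊ ⊗ F₊` (`coe_star_augTensorOps`), so its unital extension `Δ` is an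
algebra map. In the coassociativity and counit laws both sides respect the nine operations and agree
on `V`, which generates `F`. For coassociativity, both bracketings of the triple tensor product
carry the operation `μ ⊗ μ ⊗ e + μ ⊗ e ⊗ u + e ⊗ u ⊗ u`.

Connectedness. The same formula yields `e(Fᵣ, Fₛ) ⊆ Fᵣ₊ₛ` (`bilin_mem_connFiltration`), so the union
of the filtration is stable under the operations and contains `V`. The antipode is then the
geometric series `∑ (ηε - id)ⁿ` for convolution, a finite sum on each `Fᵣ` (`exists_antipode`).

The commutative case differs only in that `F ⊠ F` must be commutative for freeness to apply. -/

/-! ### The relations as a list of pairs of trilinear maps -/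

namespace DNOps

variable {k : Type u} {A : Type v} [Field k] [AddCommGroup A] [Module k A]

/-- The trilinear map `(x, y, z) ↦ ∑ (x c y) d z`, for `(c, d)` in the list `l`. -/
noncomputable def lhs (o : DNOps k A) (l : List (DNOp × DNOp)) : A →ₗ[k] A →ₗ[k] A →ₗ[k] A :=
  (l.map fun p => (o p.1).compr₂ (o p.2)).sum

/-- The trilinear map `(x, y, z) ↦ ∑ x c (y d z)`, for `(c, d)` in the list `l`. -/
noncomputable def rhs (o : DNOps k A) (l : List (DNOp × DNOp)) : A →ₗ[k] A →ₗ[k] A →ₗ[k] A :=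
  (l.map fun p => (LinearMap.llcomp k A A A).compl₁₂ (o p.1) (o p.2)).sum

theorem lhs_apply (o : DNOps k A) (l : List (DNOp × DNOp)) (x y z : A) :
    o.lhs l x y z = (l.map fun p => o p.2 (o p.1 x y) z).sum := by
  induction l with
  | nil => rfl
  | cons p l ih => simpa [lhs] using ih

theorem rhs_apply (o : DNOps k A) (l : List (DNOp × DNOp)) (x y z : A) :
    o.rhs l x y z = (l.map fun p => o p.1 x (o p.2 y z)).sum := by
  induction l with
  | nil => rfl
  | cons p l ih => simpa [rhs] using ih

end DNOps

namespace DNOp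

/-- The operations that sum to `◁`. -/
def lts : List DNOp := [nw, sw, pre]
/-- The operations that sum to `▷`. -/
def rts : List DNOp := [ne, se, suc]
/-- The operations that sum to `•̄`. -/
def bbs : List DNOp := [up, dn, bul]
/-- The operations that sum to `∧`. -/
def wes : List DNOp := [nw, ne, up]
/-- The operations that sum to `∨`. -/
def ves : List DNOp := [se, sw, dn]
/-- The operations that sum to `⋆̃`. -/
def tss : List DNOp := [pre, suc, bul]
/-- All the operations. -/
def all : List DNOp := [ne, se, sw, nw, up, dn, pre, suc, bul]

/-- The 28 relations, each of them encoded by the pairs `(c, d)` for which `(x c y) d z` occurs on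
the left, and the pairs for which `x c (y d z)` occurs on the right. -/
def relations : List (List (DNOp × DNOp) × List (DNOp × DNOp)) :=
  [([(nw, nw)], all.map (nw, ·)),
   ([(ne, nw)], lts.map (ne, ·)),
   (wes.map (·, ne), rts.map (ne, ·)),
   ([(sw, nw)], wes.map (sw, ·)),
   ([(se, nw)], [(se, nw)]),
   (ves.map (·, ne), [(se, ne)]),
   (lts.map (·, sw), ves.map (sw, ·)),
   (rts.map (·, sw), [(se, sw)]),
   (all.map (·, se), [(se, se)]),
   ([(sw, pre)], tss.map (sw, ·)),
   ([(se, pre)], [(se, pre)]),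
   (ves.map (·, suc), [(se, suc)]),
   ([(nw, pre)], ves.map (pre, ·)),
   ([(ne, pre)], [(suc, sw)]),
   (wes.map (·, suc), [(suc, se)]),
   ([(pre, nw)], wes.map (pre, ·)),
   ([(suc, nw)], [(suc, nw)]),
   (tss.map (·, ne), [(suc, ne)]),
   ([(pre, pre)], tss.map (pre, ·)),
   ([(suc, pre)], [(suc, pre)]),
   (tss.map (·, suc), [(suc, suc)]),
   (wes.map (·, up) ++ [(up, nw)], bbs.map (ne, ·) ++ all.map (up, ·)),
   (ves.map (·, up) ++ [(dn, nw)], [(se, up)] ++ wes.map (dn, ·)),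
   (all.map (·, dn) ++ bbs.map (·, sw), [(se, dn)] ++ ves.map (dn, ·)),
   (ves.map (·, bul) ++ [(dn, pre)], [(se, bul)] ++ tss.map (dn, ·)),
   (wes.map (·, bul) ++ [(up, pre)], [(suc, dn)] ++ ves.map (bul, ·)),
   (tss.map (·, up) ++ [(bul, nw)], [(suc, up)] ++ wes.map (bul, ·)),
   (tss.map (·, bul) ++ [(bul, pre)], [(suc, bul)] ++ tss.map (bul, ·))]

end DNOp

/-- Encoding the relations as equalities of trilinear maps lets all 28 be tested on a spanning set,
or moved along a linear injection, in a single argument. -/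
theorem isDendNij_iff {k : Type u} {A : Type v} [Field k] [AddCommGroup A] [Module k A]
    {o : DNOps k A} : IsDendNij o ↔
      ∀ r ∈ DNOp.relations, ∀ x y z, o.lhs r.1 x y z = o.rhs r.2 x y z := by
  simp only [DNOps.lhs_apply, DNOps.rhs_apply, DNOp.relations, DNOp.lts, DNOp.rts, DNOp.bbs,
    DNOp.wes, DNOp.ves, DNOp.tss, DNOp.all, List.forall_mem_cons, List.map_cons, List.map_nil,
    List.sum_cons, List.sum_nil, List.cons_append, List.nil_append, add_zero]
  constructor
  · rintro ⟨⟩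
    simp only [DNOps.star, DNOps.lt, DNOps.rt, DNOps.bb, DNOps.we, DNOps.ve, DNOps.ts, map_add,
      LinearMap.add_apply, add_assoc] at *
    simp only [List.not_mem_nil, false_implies, implies_true, and_true]
    refine ⟨?_, ?_, ?_, ?_, ?_, ?_, ?_, ?_, ?_, ?_, ?_, ?_, ?_, ?_, ?_, ?_, ?_, ?_, ?_, ?_, ?_,
      ?_, ?_, ?_, ?_, ?_, ?_, ?_⟩ <;> assumption
  · rintro ⟨h1, h2, h3, h4, h5, h6, h7, h8, h9, h10, h11, h12, h13, h14, h15, h16, h17, h18, h19,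
      h20, h21, h22, h23, h24, h25, h26, h27, h28, -⟩
    constructor <;> (try simp only [DNOps.star, DNOps.lt, DNOps.rt, DNOps.bb, DNOps.we, DNOps.ve,
      DNOps.ts, map_add, LinearMap.add_apply, add_assoc]) <;> assumption

theorem LinearMap.trilinear_eqOn_span {k : Type u} {M : Type v} {N : Type w} [Field k]
    [AddCommGroup M] [Module k M] [AddCommGroup N] [Module k N] {f g : M →ₗ[k] M →ₗ[k] M →ₗ[k] N}
    {s : Set M} (h : ∀ x ∈ s, ∀ y ∈ s, ∀ z ∈ s, f x y z = g x y z) :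
    ∀ x ∈ Submodule.span k s, ∀ y ∈ Submodule.span k s, ∀ z ∈ Submodule.span k s,
      f x y z = g x y z := by
  have h1 : ∀ x ∈ s, ∀ y ∈ s, ∀ z ∈ Submodule.span k s, f x y z = g x y z := fun x hx y hy z hz =>
    LinearMap.eqOn_span (h x hx y hy) hz
  have h2 : ∀ x ∈ s, ∀ y ∈ Submodule.span k s, ∀ z ∈ Submodule.span k s, f x y z = g x y z :=
    fun x hx y hy z hz => LinearMap.eqOn_span (f := (f x).flip z) (g := (g x).flip z)
      (fun y hy => h1 x hx y hy z hz) hy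
  exact fun x hx y hy z hz => LinearMap.eqOn_span (f := (LinearMap.applyₗ z) ∘ₗ f.flip y)
    (g := (LinearMap.applyₗ z) ∘ₗ g.flip y) (fun x hx => h2 x hx y hy z hz) hx

/-! ### Coherence of the unit action -/

section Coherence

variable {k : Type u} {A : Type v} {B : Type w} [Field k] [AddCommGroup A] [Module k A]
  [AddCommGroup B] [Module k B] {oA : DNOps k A} {oB : DNOps k B}

namespace Aug

theorem incl_mul_incl (hA : IsDendNij oA) (x y : A) :
    incl hA x * incl hA y = incl hA (oA.star x y) := by
  simp only [incl, LinearMap.comp_apply, LinearEquiv.coe_coe, Unitization.inrHom_apply,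
    ← Unitization.inr_mul, StarAlg.of_mul_of]

theorem exists_eq_add (hA : IsDendNij oA) (x : Aug hA) : ∃ a, x = x.fst • 1 + incl hA a :=
  ⟨proj hA x, by ext <;> simp [incl, proj]⟩

theorem fst_incl (hA : IsDendNij oA) (x : A) : (incl hA x).fst = 0 := rfl

end Aug

/-- A generating set of `augTensor`, convenient for computing with `tensorOp`. -/
def augTensorGen (hA : IsDendNij oA) (hB : IsDendNij oB) : Set (Aug hA ⊗[k] Aug hB) :=
  {t | (∃ a, t = Aug.incl hA a ⊗ₜ 1) ∨ ∃ a b, t = a ⊗ₜ Aug.incl hB b}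

theorem augTensor_eq_span (hA : IsDendNij oA) (hB : IsDendNij oB) :
    augTensor hA hB = Submodule.span k (augTensorGen hA hB) := by
  refine le_antisymm (Submodule.span_le.2 ?_) (Submodule.span_le.2 ?_)
  · rintro t ((⟨a, rfl⟩ | ⟨b, rfl⟩) | ⟨a, b, rfl⟩)
    · exact Submodule.subset_span (.inl ⟨a, rfl⟩)
    · exact Submodule.subset_span (.inr ⟨1, b, rfl⟩)
    · exact Submodule.subset_span (.inr ⟨_, b, rfl⟩)
  · rintro t (⟨a, rfl⟩ | ⟨a, b, rfl⟩)
    · exact Submodule.subset_span (.inl (.inl ⟨a, rfl⟩))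
    · obtain ⟨a', ha⟩ := Aug.exists_eq_add hA a
      rw [ha, TensorProduct.add_tmul, ← TensorProduct.smul_tmul']
      exact add_mem (Submodule.smul_mem _ _ (Submodule.subset_span (.inl (.inr ⟨b, rfl⟩))))
        (Submodule.subset_span (.inr ⟨a', b, rfl⟩))

theorem incl_tmul_one_mem (hA : IsDendNij oA) (hB : IsDendNij oB) (a : A) :
    Aug.incl hA a ⊗ₜ 1 ∈ augTensor hA hB :=
  augTensor_eq_span hA hB ▸ Submodule.subset_span (.inl ⟨a, rfl⟩)

theorem tmul_incl_mem (hA : IsDendNij oA) (hB : IsDendNij oB) (a : Aug hA) (b : B) :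
    a ⊗ₜ Aug.incl hB b ∈ augTensor hA hB :=
  augTensor_eq_span hA hB ▸ Submodule.subset_span (.inr ⟨a, b, rfl⟩)

/-- The meaningless `1 ⋄ 1` never survives: a generator with second leg `1` has its first leg in
`A`, so two such generators multiply through the operation of `A`. -/
theorem tensorOp_mem (hA : IsDendNij oA) (hB : IsDendNij oB) (c : DNOp)
    {x y : Aug hA ⊗[k] Aug hB} (hx : x ∈ augTensor hA hB) (hy : y ∈ augTensor hA hB) :
    tensorOp hA hB c x y ∈ augTensor hA hB := by
  have key := Submodule.apply_mem_map₂ (tensorOp hA hB c) hx hy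
  refine (?_ : Submodule.map₂ _ _ _ ≤ augTensor hA hB) key
  rw [augTensor_eq_span, Submodule.map₂_span_span, Submodule.span_le, ← augTensor_eq_span]
  rintro _ ⟨x, hx, y, hy, rfl⟩
  obtain ⟨a, rfl⟩ | ⟨a, b, rfl⟩ := hx <;> obtain ⟨a', rfl⟩ | ⟨a', b', rfl⟩ := hy <;>
    simp only [SetLike.mem_coe]
  · rw [tensorOp_one_one, extOp_incl_incl]
    exact incl_tmul_one_mem hA hB _
  · rw [tensorOp_right, extOp_one_incl, ← map_smul]
    exact tmul_incl_mem hA hB _ _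
  · rw [tensorOp_left, extOp_incl_one, ← map_smul]
    exact tmul_incl_mem hA hB _ _
  · rw [tensorOp_left, extOp_incl_incl]
    exact tmul_incl_mem hA hB _ _

/-- The operations of `augTensor`. -/
noncomputable def augTensorOps (hA : IsDendNij oA) (hB : IsDendNij oB) :
    DNOps k (augTensor hA hB) := fun c =>
  LinearMap.mk₂ k (fun x y => ⟨tensorOp hA hB c x y, tensorOp_mem hA hB c x.2 y.2⟩)
    (fun x x' y => by ext; simp) (fun r x y => by ext; simp)
    (fun x y y' => by ext; simp) (fun r x y => by ext; simp)

theorem coe_augTensorOps (hA : IsDendNij oA) (hB : IsDendNij oB) (c : DNOp)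
    (x y : augTensor hA hB) :
    (augTensorOps hA hB c x y : Aug hA ⊗[k] Aug hB) = tensorOp hA hB c x y := rfl

set_option maxHeartbeats 1000000 in
theorem tensorOp_relations (hA : IsDendNij oA) (hB : IsDendNij oB) :
    ∀ r ∈ DNOp.relations, ∀ x ∈ augTensor hA hB, ∀ y ∈ augTensor hA hB, ∀ z ∈ augTensor hA hB,
      DNOps.lhs (tensorOp hA hB) r.1 x y z = DNOps.rhs (tensorOp hA hB) r.2 x y z := by
  intro r hr
  rw [augTensor_eq_span]
  apply LinearMap.trilinear_eqOn_span
  -- Needed when the first two second legs are `1` and the third is not: the left side then contains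
  -- the sum over all `c` of `(a c a') ⋆̄ α`, the right side `a ⋆̄ (a' ⋆̄ α)`.
  have expand : ∀ (x : A) (y : A) (α : Aug hA), Aug.incl hA x * (Aug.incl hA y * α)
      = Aug.incl hA (oA.star x y) * α := fun x y α => by rw [← mul_assoc, Aug.incl_mul_incl]
  rintro x (⟨a, rfl⟩ | ⟨a, b, rfl⟩) y (⟨a', rfl⟩ | ⟨a', b', rfl⟩) z (⟨a'', rfl⟩ | ⟨a'', b'', rfl⟩)
  · have h := congrArg (fun t => Aug.incl hA t ⊗ₜ[k] (1 : Aug hB))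
      (isDendNij_iff.1 hA r hr a a' a'')
    simp only [DNOps.lhs_apply, DNOps.rhs_apply, tensorOp_one_one, extOp_incl_incl] at h ⊢
    have e (l : List A) : Aug.incl hA l.sum ⊗ₜ[k] (1 : Aug hB)
        = (l.map fun t => Aug.incl hA t ⊗ₜ[k] (1 : Aug hB)).sum := by
      induction l with
      | nil => simp
      | cons t l ih => simp [TensorProduct.add_tmul, ih]
    simpa [e, Function.comp_def] using h
  case inr.inr.inr =>
    have h := congrArg (fun t => (a * a' * a'') ⊗ₜ[k] Aug.incl hB t)
      (isDendNij_iff.1 hB r hr b b' b'')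
    simp only [DNOps.lhs_apply, DNOps.rhs_apply, tensorOp_left, extOp_incl_incl] at h ⊢
    have e (l : List B) : (a * a' * a'') ⊗ₜ[k] Aug.incl hB l.sum
        = (l.map fun t => (a * a' * a'') ⊗ₜ[k] Aug.incl hB t).sum := by
      induction l with
      | nil => simp
      | cons t l ih => simp [TensorProduct.tmul_add, ih]
    rw [e, e] at h
    simpa [Function.comp_def, mul_assoc] using h
  -- Mixed cases: some but not all second legs are `1`. No relation of `A` or `B` is needed beyond
  -- associativity in `A₊`, so evaluating the unit action settles each of the 28 equations.
  all_goals
    simp only [DNOps.lhs_apply, DNOps.rhs_apply]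
    revert r
    simp only [DNOp.relations, DNOp.lts, DNOp.rts, DNOp.bbs,
      DNOp.wes, DNOp.ves, DNOp.tss, DNOp.all, List.forall_mem_cons, List.map_cons, List.map_nil,
      List.sum_cons, List.sum_nil, List.cons_append, List.nil_append, add_zero]
    simp only [tensorOp_left, tensorOp_right, tensorOp_one_one, extOp_incl_incl, extOp_one_incl,
      extOp_incl_one, DNOp.leftUnit, DNOp.rightUnit, one_smul, zero_smul, TensorProduct.tmul_zero,
      map_zero, LinearMap.zero_apply, add_zero, zero_add, mul_assoc, expand, Aug.incl_mul_incl,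
      DNOps.star, map_add, add_mul, mul_add, TensorProduct.add_tmul, add_assoc, and_true,
      List.not_mem_nil, false_implies, implies_true]
theorem isDendNij_augTensorOps (hA : IsDendNij oA) (hB : IsDendNij oB) :
    IsDendNij (augTensorOps hA hB) := by
  refine isDendNij_iff.2 fun r hr x y z => Subtype.ext ?_
  have h := tensorOp_relations hA hB r hr x x.2 y y.2 z z.2
  rw [DNOps.lhs_apply, DNOps.rhs_apply] at h ⊢
  simp only [← Submodule.subtype_apply, map_list_sum, List.map_map]
  exact h

theorem LinearMap.bilinear_eqOn_span {M : Type v} {N : Type w} [AddCommGroup M] [Module k M]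
    [AddCommGroup N] [Module k N] {f g : M →ₗ[k] M →ₗ[k] N} {s : Set M}
    (h : ∀ x ∈ s, ∀ y ∈ s, f x y = g x y) :
    ∀ x ∈ Submodule.span k s, ∀ y ∈ Submodule.span k s, f x y = g x y := by
  have h1 : ∀ x ∈ s, ∀ y ∈ Submodule.span k s, f x y = g x y := fun x hx y hy =>
    LinearMap.eqOn_span (h x hx) hy
  exact fun x hx y hy => LinearMap.eqOn_span (f := f.flip y) (g := g.flip y)
    (fun x hx => h1 x hx y hy) hx

theorem IsCommDN.star_comm (hA' : IsCommDN oA) (x y : A) : oA.star x y = oA.star y x := by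
  simp only [DNOps.star]
  rw [hA' .ne, hA' .se, hA' .sw, hA' .nw, hA' .up, hA' .dn, hA' .pre, hA' .suc, hA' .bul]
  simp only [DNOp.opp]
  abel

theorem IsCommDN.aug_mul_comm {hA : IsDendNij oA} (hA' : IsCommDN oA) (x y : Aug hA) :
    x * y = y * x := by
  obtain ⟨a, hx⟩ := Aug.exists_eq_add hA x
  obtain ⟨b, hy⟩ := Aug.exists_eq_add hA y
  rw [hx, hy]
  simp only [mul_add, add_mul, Aug.incl_mul_incl, hA'.star_comm b a, smul_mul_assoc, mul_smul_comm,
    one_mul, mul_one]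
  module

theorem isCommDN_augTensorOps (hA : IsDendNij oA) (hB : IsDendNij oB) (hA' : IsCommDN oA)
    (hB' : IsCommDN oB) : IsCommDN (augTensorOps hA hB) := by
  intro c x y
  refine Subtype.ext ?_
  have h : ∀ x ∈ augTensor hA hB, ∀ y ∈ augTensor hA hB,
      tensorOp hA hB c x y = (tensorOp hA hB c.opp).flip x y := by
    rw [augTensor_eq_span]
    apply LinearMap.bilinear_eqOn_span
    rintro x (⟨a, rfl⟩ | ⟨a, b, rfl⟩) y (⟨a', rfl⟩ | ⟨a', b', rfl⟩)
    · simp only [LinearMap.flip_apply, tensorOp_one_one, extOp_incl_incl, hA' c a a']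
    · simp only [LinearMap.flip_apply, tensorOp_right, tensorOp_left, extOp_one_incl,
        extOp_incl_one, hA'.aug_mul_comm a']
      -- The unit action is symmetric: `c.leftUnit` equals `c.opp.rightUnit`.
      cases c <;> rfl
    · simp only [LinearMap.flip_apply, tensorOp_right, tensorOp_left, extOp_one_incl,
        extOp_incl_one, hA'.aug_mul_comm a]
      cases c <;> rfl
    · simp only [LinearMap.flip_apply, tensorOp_left, extOp_incl_incl, hB' c b b',
        hA'.aug_mul_comm a]
  exact h x x.2 y y.2

/-- Exactly one operation has `1` as a right unit and exactly one has it as a left unit, so `1` is a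
two-sided unit for the sum. This is what makes `comulOf` multiplicative. -/
theorem coe_star_augTensorOps (hA : IsDendNij oA) (hB : IsDendNij oB) (x y : augTensor hA hB) :
    ((augTensorOps hA hB).star x y : Aug hA ⊗[k] Aug hB) = x * y := by
  have h : ∀ x ∈ augTensor hA hB, ∀ y ∈ augTensor hA hB,
      (DNOp.all.map (tensorOp hA hB)).sum x y = LinearMap.mul k _ x y := by
    rw [augTensor_eq_span]
    apply LinearMap.bilinear_eqOn_span
    rintro x (⟨a, rfl⟩ | ⟨a, b, rfl⟩) y (⟨a', rfl⟩ | ⟨a', b', rfl⟩) <;>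
    simp only [DNOp.all, List.map_cons, List.map_nil, List.sum_cons, List.sum_nil,
      LinearMap.add_apply, add_zero, tensorOp_one_one, tensorOp_left,
      tensorOp_right, extOp_incl_incl, extOp_one_incl, extOp_incl_one, DNOp.leftUnit,
      DNOp.rightUnit, zero_smul, one_smul, TensorProduct.tmul_zero, zero_add, LinearMap.mul_apply',
      Algebra.TensorProduct.tmul_mul_tmul, Aug.incl_mul_incl, one_mul, mul_one, DNOps.star,
      map_add, TensorProduct.add_tmul, TensorProduct.tmul_add, add_assoc]
  rw [← LinearMap.mul_apply' (R := k), ← h x x.2 y y.2]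
  simp [DNOps.star, DNOp.all, coe_augTensorOps, add_assoc]

end Coherence

/-! ### The bialgebra structure -/

/-- With `μ` the product, both bracketings expand to `μ ⊗ μ ⊗ e + μ ⊗ e ⊗ ε + e ⊗ ε ⊗ ε`. -/
theorem TensorProduct.assoc_map₂_mul {k : Type u} {H : Type v} [Field k] [Ring H] [Algebra k H]
    (e ε : H →ₗ[k] H →ₗ[k] H) (x y : (H ⊗[k] H) ⊗[k] H) :
    TensorProduct.assoc k H H H
        ((map₂ (LinearMap.mul k (H ⊗[k] H)) e + map₂ (map₂ (LinearMap.mul k H) e + map₂ e ε) ε) x y)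
      = (map₂ (LinearMap.mul k H) (map₂ (LinearMap.mul k H) e + map₂ e ε) + map₂ e (map₂ ε ε))
          (TensorProduct.assoc k H H H x) (TensorProduct.assoc k H H H y) := by
  -- The two maps stay opaque during the inductions, which use only bilinearity; they are unfolded
  -- on pure tensors.
  generalize hT : map₂ (LinearMap.mul k (H ⊗[k] H)) e
    + map₂ (map₂ (LinearMap.mul k H) e + map₂ e ε) ε = T
  generalize hT' : map₂ (LinearMap.mul k H) (map₂ (LinearMap.mul k H) e + map₂ e ε)
    + map₂ e (map₂ ε ε) = T'
  induction x using TensorProduct.induction_on with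
  | zero => simp only [map_zero, LinearMap.zero_apply]
  | add x x' hx hx' => simp only [map_add, LinearMap.add_apply, hx, hx']
  | tmul x z =>
  induction x using TensorProduct.induction_on with
  | zero => simp only [zero_tmul, map_zero, LinearMap.zero_apply]
  | add x x' hx hx' => simp only [add_tmul, map_add, LinearMap.add_apply, hx, hx']
  | tmul x x' =>
  induction y using TensorProduct.induction_on with
  | zero => simp only [map_zero]
  | add x x' hx hx' => simp only [map_add, hx, hx']
  | tmul y z' =>
  induction y using TensorProduct.induction_on with
  | zero => simp only [zero_tmul, map_zero]
  | add x x' hx hx' => simp only [add_tmul, map_add, hx, hx']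
  | tmul y y' =>
    subst hT hT'
    simp only [LinearMap.add_apply, map₂_apply_tmul, map_tmul, map_add,
      LinearMap.mul_apply', assoc_tmul, add_tmul, tmul_add, Algebra.TensorProduct.tmul_mul_tmul,
      add_assoc]

section Comul

variable {k : Type u} {A : Type v} [Field k] [AddCommGroup A] [Module k A] {o : DNOps k A}

open TensorProduct (map₂)

theorem extOp_one_right (h : IsDendNij o) (c : DNOp) (x : Aug h) :
    extOp h c x 1 = c.rightUnit k • (x - x.fst • 1) := by
  obtain ⟨a, hx⟩ := Aug.exists_eq_add h x
  nth_rw 1 2 [hx]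
  simp [extOp_incl_one, extOp_one_one]

theorem extOp_one_left (h : IsDendNij o) (c : DNOp) (x : Aug h) :
    extOp h c 1 x = c.leftUnit k • (x - x.fst • 1) := by
  obtain ⟨a, hx⟩ := Aug.exists_eq_add h x
  nth_rw 1 2 [hx]
  simp [extOp_one_incl, extOp_one_one]

theorem fst_extOp (h : IsDendNij o) (c : DNOp) (x y : Aug h) : (extOp h c x y).fst = 0 := rfl

theorem unitPart_apply (h : IsDendNij o) (x y : Aug h) :
    unitPart h x y = (x.fst * y.fst) • (1 : Aug h) := rfl

theorem tensorOp_tmul (h : IsDendNij o) (c : DNOp) (a a' b b' : Aug h) :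
    tensorOp h h c (a ⊗ₜ b) (a' ⊗ₜ b')
      = (a * a') ⊗ₜ extOp h c b b' + extOp h c a a' ⊗ₜ unitPart h b b' := rfl

/-- The unit action passes to `A ⊠ A`: `1 ⊗ 1` acts through the first leg on `a ⊗ 1`, and through
the second leg on `a ⊗ b`. -/
theorem tensorOp_one_right (h : IsDendNij o) (c : DNOp) {t : Aug h ⊗[k] Aug h}
    (ht : t ∈ augTensor h h) : tensorOp h h c t 1 = c.rightUnit k • t := by
  rw [augTensor_eq_span] at ht
  refine LinearMap.eqOn_span (f := (tensorOp h h c).flip 1) (g := c.rightUnit k • LinearMap.id)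
    ?_ ht
  rintro _ (⟨a, rfl⟩ | ⟨a, b, rfl⟩) <;>
    simp [Algebra.TensorProduct.one_def, tensorOp_one_one, tensorOp_left, extOp_incl_one,
      TensorProduct.smul_tmul']

theorem tensorOp_one_left (h : IsDendNij o) (c : DNOp) {t : Aug h ⊗[k] Aug h}
    (ht : t ∈ augTensor h h) : tensorOp h h c 1 t = c.leftUnit k • t := by
  rw [augTensor_eq_span] at ht
  refine LinearMap.eqOn_span (f := tensorOp h h c 1) (g := c.leftUnit k • LinearMap.id)
    ?_ ht
  rintro _ (⟨a, rfl⟩ | ⟨a, b, rfl⟩) <;>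
    simp [Algebra.TensorProduct.one_def, tensorOp_one_one, tensorOp_right, extOp_one_incl,
      TensorProduct.smul_tmul']

/-- The algebra morphism `A₊ → A₊ ⊗ A₊` induced by a morphism `A → A ⊠ A`. -/
noncomputable def comulOf (h : IsDendNij o) {δ : A →ₗ[k] augTensor h h}
    (hδ : IsDNHom o (augTensorOps h h) δ) : Aug h →ₐ[k] Aug h ⊗[k] Aug h :=
  Unitization.lift
    { (augTensor h h).subtype ∘ₗ δ ∘ₗ (StarAlg.of h).symm.toLinearMap with
      map_zero' := map_zero ((augTensor h h).subtype ∘ₗ δ ∘ₗ (StarAlg.of h).symm.toLinearMap)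
      map_mul' := fun x y => by
        have e := hδ.map_star ((StarAlg.of h).symm x) ((StarAlg.of h).symm y)
        have e' := congrArg Subtype.val e
        rwa [coe_star_augTensorOps] at e' }

variable (h : IsDendNij o) {δ : A →ₗ[k] augTensor h h} (hδ : IsDNHom o (augTensorOps h h) δ)

theorem comulOf_incl (x : A) : comulOf h hδ (Aug.incl h x) = δ x :=
  (Unitization.lift_symm_apply_apply (comulOf h hδ) (StarAlg.of h x)).symm.trans
    (by rw [comulOf, Equiv.symm_apply_apply]; rfl)

theorem comulOf_op (c : DNOp) (x y : A) : comulOf h hδ (Aug.incl h (o c x y))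
    = tensorOp h h c (comulOf h hδ (Aug.incl h x)) (comulOf h hδ (Aug.incl h y)) := by
  simp only [comulOf_incl, hδ c x y, coe_augTensorOps]

/-- The identity extends from `A` to `A₊` because `Δ(A)` lies in `A ⊠ A`, where `1 ⊗ 1` obeys the
unit action, and because the convention `1 ⋄ 1 = 0` holds on both sides. -/
theorem comulOf_extOp (c : DNOp) (x y : Aug h) :
    comulOf h hδ (extOp h c x y) = tensorOp h h c (comulOf h hδ x) (comulOf h hδ y) := by
  obtain ⟨a, hx⟩ := Aug.exists_eq_add h x
  obtain ⟨b, hy⟩ := Aug.exists_eq_add h y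
  have h1 : comulOf h hδ (Aug.incl h a) ∈ augTensor h h := comulOf_incl h hδ a ▸ (δ a).2
  have h2 : comulOf h hδ (Aug.incl h b) ∈ augTensor h h := comulOf_incl h hδ b ▸ (δ b).2
  have h3 : tensorOp h h c 1 1 = 0 := by
    rw [Algebra.TensorProduct.one_def, tensorOp_one_one, extOp_one_one, TensorProduct.zero_tmul]
  rw [hx, hy]
  simp only [map_add, map_smul, map_one, LinearMap.add_apply, LinearMap.smul_apply, extOp_one_one,
    extOp_one_incl, extOp_incl_one, extOp_incl_incl, tensorOp_one_left h c h2,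
    tensorOp_one_right h c h1, h3, comulOf_op, smul_zero, map_zero]

/-- The operations on `(A₊ ⊗ A₊) ⊗ A₊`. -/
noncomputable def tripleOp (c : DNOp) : (Aug h ⊗[k] Aug h) ⊗[k] Aug h →ₗ[k]
    (Aug h ⊗[k] Aug h) ⊗[k] Aug h →ₗ[k] (Aug h ⊗[k] Aug h) ⊗[k] Aug h :=
  map₂ (LinearMap.mul k _) (extOp h c) + map₂ (tensorOp h h c) (unitPart h)

/-- The operations on `A₊ ⊗ (A₊ ⊗ A₊)`. -/
noncomputable def tripleOp' (c : DNOp) : Aug h ⊗[k] (Aug h ⊗[k] Aug h) →ₗ[k]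
    Aug h ⊗[k] (Aug h ⊗[k] Aug h) →ₗ[k] Aug h ⊗[k] (Aug h ⊗[k] Aug h) :=
  map₂ (LinearMap.mul k _) (tensorOp h h c)
    + map₂ (extOp h c) (map₂ (unitPart h) (unitPart h))

theorem assoc_tripleOp (c : DNOp) (x y : (Aug h ⊗[k] Aug h) ⊗[k] Aug h) :
    TensorProduct.assoc k _ _ _ (tripleOp h c x y)
      = tripleOp' h c (TensorProduct.assoc k _ _ _ x) (TensorProduct.assoc k _ _ _ y) :=
  TensorProduct.assoc_map₂_mul (extOp h c) (unitPart h) x y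

theorem map_comulOf_id_tensorOp (c : DNOp) (x y : Aug h ⊗[k] Aug h) :
    TensorProduct.map (comulOf h hδ).toLinearMap LinearMap.id (tensorOp h h c x y)
      = tripleOp h c (TensorProduct.map (comulOf h hδ).toLinearMap LinearMap.id x)
          (TensorProduct.map (comulOf h hδ).toLinearMap LinearMap.id y) := by
  induction x using TensorProduct.induction_on with
  | zero => simp
  | add x x' hx hx' => simp only [map_add, LinearMap.add_apply, hx, hx']
  | tmul x x' =>
  induction y using TensorProduct.induction_on with
  | zero => simp
  | add x x' hx hx' => simp only [map_add, hx, hx']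
  | tmul y y' =>
    simp [tripleOp, tensorOp_tmul, comulOf_extOp]

/-- Every generator of `A ⊠ A` has a leg in `A`, on which `ε` vanishes. -/
theorem unitPart_tmul_eq_zero {x : Aug h ⊗[k] Aug h} (hx : x ∈ augTensor h h)
    (y : Aug h ⊗[k] Aug h) : map₂ (unitPart h) (unitPart h) x y = 0 ∧
      map₂ (unitPart h) (unitPart h) y x = 0 := by
  induction y using TensorProduct.induction_on with
  | zero => simp
  | add x x' hx hx' => simp [hx.1, hx'.1, hx.2, hx'.2]
  | tmul y y' =>
    rw [augTensor_eq_span] at hx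
    induction hx using Submodule.span_induction with
    | zero => simp
    | add x x' _ _ hx hx' =>
      simp only [map_add, LinearMap.add_apply, hx.1, hx'.1, hx.2, hx'.2, add_zero, and_self]
    | smul r x _ hx =>
      simp only [map_smul, LinearMap.smul_apply, hx.1, hx.2, smul_zero, and_self]
    | mem x hx =>
      obtain ⟨a, rfl⟩ | ⟨a, b, rfl⟩ := hx <;> simp [unitPart_apply, Aug.fst_incl]

/-- Only the scalar parts of `x` and `y` contribute, since `ε ⊗ ε` kills `Δ(A)`. This handles the
last summand of `tripleOp'`. -/
theorem unitPart_comulOf (x y : Aug h) :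
    map₂ (unitPart h) (unitPart h) (comulOf h hδ x) (comulOf h hδ y)
      = comulOf h hδ (unitPart h x y) := by
  obtain ⟨a, hx⟩ := Aug.exists_eq_add h x
  obtain ⟨b, hy⟩ := Aug.exists_eq_add h y
  have h1 := unitPart_tmul_eq_zero h (comulOf_incl h hδ a ▸ (δ a).2)
  have h2 := unitPart_tmul_eq_zero h (comulOf_incl h hδ b ▸ (δ b).2)
  have h3 : map₂ (unitPart h) (unitPart h) 1 1 = 1 := by
    simp [Algebra.TensorProduct.one_def, unitPart_apply]
  nth_rw 1 [hx, hy]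
  simp [h1, h2, h3, unitPart_apply, smul_smul]

theorem map_id_comulOf_tensorOp (c : DNOp) (x y : Aug h ⊗[k] Aug h) :
    TensorProduct.map LinearMap.id (comulOf h hδ).toLinearMap (tensorOp h h c x y)
      = tripleOp' h c (TensorProduct.map LinearMap.id (comulOf h hδ).toLinearMap x)
          (TensorProduct.map LinearMap.id (comulOf h hδ).toLinearMap y) := by
  induction x using TensorProduct.induction_on with
  | zero => simp
  | add x x' hx hx' => simp only [map_add, LinearMap.add_apply, hx, hx']
  | tmul x x' =>
  induction y using TensorProduct.induction_on with
  | zero => simp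
  | add x x' hx hx' => simp only [map_add, hx, hx']
  | tmul y y' =>
    simp only [tripleOp', tensorOp_tmul, map_add, LinearMap.id_apply,
      AlgHom.toLinearMap_apply, comulOf_extOp, LinearMap.add_apply, TensorProduct.map₂_apply_tmul,
      TensorProduct.map_tmul, LinearMap.mul_apply', unitPart_comulOf]

/-- The counit of `A₊`. -/
noncomputable def Aug.counit : Aug h →ₐ[k] k := Unitization.fstHom k (StarAlg h)

/-- As `ε` vanishes on values of `extOp`, the map `ε ⊗ id` kills the summand `e ⊗ u` and leaves
`ε(a) ε(a') e(b, b')`. -/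
theorem lid_map_counit_tensorOp (c : DNOp) (x y : Aug h ⊗[k] Aug h) :
    TensorProduct.lid k _ (TensorProduct.map (Aug.counit h).toLinearMap LinearMap.id
        (tensorOp h h c x y))
      = extOp h c
          (TensorProduct.lid k _ (TensorProduct.map (Aug.counit h).toLinearMap LinearMap.id x))
          (TensorProduct.lid k _ (TensorProduct.map (Aug.counit h).toLinearMap LinearMap.id y)) := by
  induction x using TensorProduct.induction_on with
  | zero => simp
  | add x x' hx hx' => simp only [map_add, LinearMap.add_apply, hx, hx']
  | tmul x x' =>
  induction y using TensorProduct.induction_on with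
  | zero => simp
  | add x x' hx hx' => simp only [map_add, hx, hx']
  | tmul y y' =>
    simp [tensorOp_tmul, Aug.counit, fst_extOp, smul_smul, mul_comm]

/-- Here `id ⊗ ε` kills the summand `μ ⊗ e`, and `e ⊗ u` gives `ε(b) ε(b') e(a, a')`. -/
theorem rid_map_counit_tensorOp (c : DNOp) (x y : Aug h ⊗[k] Aug h) :
    TensorProduct.rid k _ (TensorProduct.map LinearMap.id (Aug.counit h).toLinearMap
        (tensorOp h h c x y))
      = extOp h c
          (TensorProduct.rid k _ (TensorProduct.map LinearMap.id (Aug.counit h).toLinearMap x))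
          (TensorProduct.rid k _ (TensorProduct.map LinearMap.id (Aug.counit h).toLinearMap y)) := by
  induction x using TensorProduct.induction_on with
  | zero => simp
  | add x x' hx hx' => simp only [map_add, LinearMap.add_apply, hx, hx']
  | tmul x x' =>
  induction y using TensorProduct.induction_on with
  | zero => simp
  | add x x' hx hx' => simp only [map_add, hx, hx']
  | tmul y y' =>
    simp [tensorOp_tmul, Aug.counit, fst_extOp, unitPart_apply, smul_smul, mul_comm]

/-- `A` is generated by `i : V → A`. -/
def DNGenerates {V : Type w} [AddCommGroup V] [Module k V] (o : DNOps k A) (i : V →ₗ[k] A) :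
    Prop :=
  ∀ p : Submodule k A, (∀ v, i v ∈ p) → (∀ c, ∀ x ∈ p, ∀ y ∈ p, o c x y ∈ p) → p = ⊤

theorem DNGenerates.algHom_ext {V : Type w} [AddCommGroup V] [Module k V] {i : V →ₗ[k] A}
    (hi : DNGenerates o i) {R : Type*} [Ring R] [Algebra k R] {f g : Aug h →ₐ[k] R}
    (h₁ : ∀ v, f (Aug.incl h (i v)) = g (Aug.incl h (i v)))
    (h₂ : ∀ c x y, f (Aug.incl h x) = g (Aug.incl h x) → f (Aug.incl h y) = g (Aug.incl h y) →
      f (Aug.incl h (o c x y)) = g (Aug.incl h (o c x y))) : f = g := by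
  have e := hi (LinearMap.eqLocus (f.toLinearMap ∘ₗ Aug.incl h) (g.toLinearMap ∘ₗ Aug.incl h)) h₁
    fun c x hx y hy => h₂ c x y hx hy
  ext x
  have hx : x ∈ (⊤ : Submodule k A) := trivial
  rw [← e] at hx
  exact hx

variable {V : Type w} [AddCommGroup V] [Module k V] {i : V →ₗ[k] A} (hi : DNGenerates o i)
  (hv : ∀ v, (δ (i v) : Aug h ⊗[k] Aug h) = 1 ⊗ₜ Aug.incl h (i v) + Aug.incl h (i v) ⊗ₜ 1)

include hi hv

/-- Restricted to `A`, both composites carry the nine operations to `tripleOp'`, and they agree on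
the generators. -/
theorem comulOf_coassoc :
    (Algebra.TensorProduct.assoc k k k (Aug h) (Aug h) (Aug h)).toAlgHom.comp
      ((Algebra.TensorProduct.map (comulOf h hδ) (.id k (Aug h))).comp (comulOf h hδ))
      = (Algebra.TensorProduct.map (.id k (Aug h)) (comulOf h hδ)).comp (comulOf h hδ) := by
  refine hi.algHom_ext h (fun v => ?_) fun c x y hx hy => ?_
  · simp [comulOf_incl, hv, TensorProduct.tmul_add, TensorProduct.add_tmul,
      Algebra.TensorProduct.one_def, add_assoc]
  · simp only [AlgHom.comp_apply, comulOf_op] at hx hy ⊢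
    have h1 := assoc_tripleOp h c
      (TensorProduct.map (comulOf h hδ).toLinearMap LinearMap.id (comulOf h hδ (Aug.incl h x)))
      (TensorProduct.map (comulOf h hδ).toLinearMap LinearMap.id (comulOf h hδ (Aug.incl h y)))
    rw [← map_comulOf_id_tensorOp] at h1
    refine h1.trans ?_
    refine Eq.trans ?_ (map_id_comulOf_tensorOp h hδ c _ _).symm
    exact congrArg₂ (fun s t => tripleOp' h c s t) hx hy

theorem comulOf_rTensor_counit :
    (Algebra.TensorProduct.map (Aug.counit h) (.id k (Aug h))).comp (comulOf h hδ)
      = (Algebra.TensorProduct.lid k (Aug h)).symm := by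
  refine hi.algHom_ext h (fun v => ?_) fun c x y hx hy => ?_
  · simp [comulOf_incl, hv, Aug.counit, Aug.fst_incl]
  · have hx' := congrArg (TensorProduct.lid k (Aug h)) hx
    have hy' := congrArg (TensorProduct.lid k (Aug h)) hy
    have e : ∀ x, TensorProduct.lid k (Aug h)
        (((Algebra.TensorProduct.lid k (Aug h)).symm : Aug h →ₐ[k] _) x) = x :=
      (Algebra.TensorProduct.lid k (Aug h)).apply_symm_apply
    apply (TensorProduct.lid k (Aug h)).injective
    simp only [AlgHom.comp_apply, comulOf_op, e] at hx' hy' ⊢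
    refine (lid_map_counit_tensorOp h c _ _).trans ?_
    refine (congrArg₂ (fun s t => extOp h c s t) hx' hy').trans ?_
    exact extOp_incl_incl h c x y

theorem comulOf_lTensor_counit :
    (Algebra.TensorProduct.map (.id k (Aug h)) (Aug.counit h)).comp (comulOf h hδ)
      = (Algebra.TensorProduct.rid k k (Aug h)).symm := by
  refine hi.algHom_ext h (fun v => ?_) fun c x y hx hy => ?_
  · simp [comulOf_incl, hv, Aug.counit, Aug.fst_incl]
  · have hx' := congrArg (TensorProduct.rid k (Aug h)) hx
    have hy' := congrArg (TensorProduct.rid k (Aug h)) hy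
    have e : ∀ x, TensorProduct.rid k (Aug h)
        (((Algebra.TensorProduct.rid k k (Aug h)).symm : Aug h →ₐ[k] _) x) = x :=
      (Algebra.TensorProduct.rid k k (Aug h)).apply_symm_apply
    apply (TensorProduct.rid k (Aug h)).injective
    simp only [AlgHom.comp_apply, comulOf_op, e] at hx' hy' ⊢
    refine (rid_map_counit_tensorOp h c _ _).trans ?_
    refine (congrArg₂ (fun s t => extOp h c s t) hx' hy').trans ?_
    exact extOp_incl_incl h c x y

end Comul

/-! ### Connected bialgebras -/

section Connected

variable {k : Type u} {H : Type v} [Field k] [Ring H] [Algebra k H] (Δ : H →ₐ[k] H ⊗[k] H)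

/-- The subspace `Fᵣ ⊗ Fᵣ`. -/
noncomputable def connTensor (r : ℕ) : Submodule k (H ⊗[k] H) :=
  LinearMap.range (TensorProduct.map (connFiltration Δ r).subtype (connFiltration Δ r).subtype)

theorem connTensor_eq_map₂ (r : ℕ) : connTensor Δ r
    = Submodule.map₂ (TensorProduct.mk k H H) (connFiltration Δ r) (connFiltration Δ r) := by
  rw [connTensor, TensorProduct.range_map, Submodule.range_subtype]

theorem mem_connFiltration_succ {r : ℕ} {x : H} :
    x ∈ connFiltration Δ (r + 1) ↔ reducedComul Δ x ∈ connTensor Δ r := Iff.rfl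

theorem reducedComul_apply (x : H) : reducedComul Δ x = Δ x - 1 ⊗ₜ x - x ⊗ₜ 1 := rfl

variable {Δ}

theorem tmul_mem_connTensor {r : ℕ} {x y : H} (hx : x ∈ connFiltration Δ r)
    (hy : y ∈ connFiltration Δ r) : x ⊗ₜ y ∈ connTensor Δ r :=
  connTensor_eq_map₂ Δ r ▸ Submodule.apply_mem_map₂ _ hx hy

theorem connTensor_mono {r s : ℕ} (h : connFiltration Δ r ≤ connFiltration Δ s) :
    connTensor Δ r ≤ connTensor Δ s := by
  rw [connTensor_eq_map₂, connTensor_eq_map₂]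
  exact Submodule.map₂_le_map₂ h h

variable (Δ)

/-- The base case holds because the reduced coproduct of `1` is `-1 ⊗ 1`; afterwards `Fᵣ ⊗ Fᵣ` grows
with `Fᵣ`. -/
theorem connFiltration_mono : Monotone (connFiltration Δ) := by
  refine monotone_nat_of_le_succ fun r => ?_
  induction r with
  | zero =>
    refine Submodule.span_le.2 (Set.singleton_subset_iff.2 ?_)
    have h1 : (1 : H) ∈ connFiltration Δ 0 := Submodule.mem_span_singleton_self 1
    rw [SetLike.mem_coe, mem_connFiltration_succ, reducedComul_apply, map_one,
      Algebra.TensorProduct.one_def, sub_self, zero_sub]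
    exact neg_mem (tmul_mem_connTensor h1 h1)
  | succ r ih => exact fun x hx => connTensor_mono ih hx

theorem one_mem_connFiltration (r : ℕ) : (1 : H) ∈ connFiltration Δ r :=
  connFiltration_mono Δ (Nat.zero_le r) (Submodule.mem_span_singleton_self 1)

variable {Δ}

/-- Each `Fᵣ` is a subcoalgebra: `Fᵣ ⊆ Fᵣ₊₁` puts the reduced coproduct in `Fᵣ ⊗ Fᵣ`, and the two
primitive terms lie there because `1 ∈ Fᵣ`. -/
theorem comul_mem_connTensor {r : ℕ} {x : H} (hx : x ∈ connFiltration Δ r) :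
    Δ x ∈ connTensor Δ r := by
  have h1 := one_mem_connFiltration Δ r
  have h2 := (mem_connFiltration_succ Δ).1 (connFiltration_mono Δ (Nat.le_succ r) hx)
  have e : Δ x = reducedComul Δ x + 1 ⊗ₜ x + x ⊗ₜ 1 := by rw [reducedComul_apply]; abel
  rw [e]
  exact add_mem (add_mem h2 (tmul_mem_connTensor h1 hx)) (tmul_mem_connTensor hx h1)

/-- A bilinear map on `H ⊗ H` sends `Fᵣ ⊗ Fᵣ` and `Fₛ ⊗ Fₛ` into `Fₙ ⊗ Fₙ` if it does so on pure
tensors. -/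
theorem bilin_mem_connTensor {T : H ⊗[k] H →ₗ[k] H ⊗[k] H →ₗ[k] H ⊗[k] H} {r s n : ℕ}
    (h : ∀ a ∈ connFiltration Δ r, ∀ b ∈ connFiltration Δ r, ∀ a' ∈ connFiltration Δ s,
      ∀ b' ∈ connFiltration Δ s, T (a ⊗ₜ b) (a' ⊗ₜ b') ∈ connTensor Δ n)
    {x y : H ⊗[k] H} (hx : x ∈ connTensor Δ r) (hy : y ∈ connTensor Δ s) :
    T x y ∈ connTensor Δ n := by
  have h1 : ∀ a ∈ connFiltration Δ r, ∀ b ∈ connFiltration Δ r,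
      connTensor Δ s ≤ (connTensor Δ n).comap (T (a ⊗ₜ b)) := fun a ha b hb => by
    rw [connTensor_eq_map₂, Submodule.map₂_le]
    exact fun a' ha' b' hb' => h a ha b hb a' ha' b' hb'
  have h2 : connTensor Δ r ≤ (connTensor Δ n).comap (T.flip y) := by
    rw [connTensor_eq_map₂ Δ r, Submodule.map₂_le]
    exact fun a ha b hb => h1 a ha b hb hy
  exact h2 hx

theorem mem_connTensor_of_add_le {e ε : H →ₗ[k] H →ₗ[k] H}
    (hε : ∀ x y r, ε x y ∈ connFiltration Δ r) {r s n : ℕ} (hn : r + s ≤ n)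
    (hm : ∀ x ∈ connFiltration Δ r, ∀ y ∈ connFiltration Δ s, x * y ∈ connFiltration Δ (r + s))
    (he : ∀ x ∈ connFiltration Δ r, ∀ y ∈ connFiltration Δ s, e x y ∈ connFiltration Δ (r + s))
    {x y : H ⊗[k] H} (hx : x ∈ connTensor Δ r) (hy : y ∈ connTensor Δ s) :
    (TensorProduct.map₂ (LinearMap.mul k H) e + TensorProduct.map₂ e ε) x y ∈ connTensor Δ n := by
  refine connTensor_mono (connFiltration_mono Δ hn)
    (bilin_mem_connTensor (fun a ha b hb a' ha' b' hb' => ?_) hx hy)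
  exact add_mem (tmul_mem_connTensor (hm a ha a' ha') (he b hb b' hb'))
    (tmul_mem_connTensor (he a ha a' ha') (hε b b' _))

/-- A bilinear map `e` respects the filtration if `Δ` intertwines it with `μ ⊗ e + e ⊗ ε`, where `μ`
is the product and `ε` has scalar values. -/
theorem bilin_mem_connFiltration {e ε : H →ₗ[k] H →ₗ[k] H}
    (hε : ∀ x y r, ε x y ∈ connFiltration Δ r)
    (hΔ : ∀ x y, Δ (e x y)
      = (TensorProduct.map₂ (LinearMap.mul k H) e + TensorProduct.map₂ e ε) (Δ x) (Δ y))
    (h0 : ∀ x y, e 1 1 ⊗ₜ[k] ε x y = 0) (h1 : ∀ x y, (x * y) ⊗ₜ[k] e 1 1 + e x y ⊗ₜ[k] ε 1 1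
      = e x y ⊗ₜ[k] 1)
    (hl : ∀ r, ∀ x ∈ connFiltration Δ r, e 1 x ∈ connFiltration Δ r)
    (hr : ∀ r, ∀ x ∈ connFiltration Δ r, e x 1 ∈ connFiltration Δ r)
    (hm : ∀ n, (∀ r s, r + s < n → ∀ x ∈ connFiltration Δ r, ∀ y ∈ connFiltration Δ s,
        e x y ∈ connFiltration Δ (r + s)) → ∀ r s, r + s < n → ∀ x ∈ connFiltration Δ r,
        ∀ y ∈ connFiltration Δ s, x * y ∈ connFiltration Δ (r + s))
    (r s : ℕ) : ∀ x ∈ connFiltration Δ r, ∀ y ∈ connFiltration Δ s,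
      e x y ∈ connFiltration Δ (r + s) := by
  induction hn : r + s using Nat.strong_induction_on generalizing r s with
  | _ n ih =>
  subst hn
  replace ih : ∀ r' s', r' + s' < r + s → ∀ x ∈ connFiltration Δ r', ∀ y ∈ connFiltration Δ s',
      e x y ∈ connFiltration Δ (r' + s') := fun r' s' h => ih _ h r' s' rfl
  -- When `e` is the product, `hm` merely returns the induction hypothesis; for other `e` it is
  -- supplied by the result for the product. One induction thus serves both.
  have hm := hm _ ih
  intro x hx y hy
  obtain _ | r := r
  · obtain ⟨a, rfl⟩ := Submodule.mem_span_singleton.1 hx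
    rw [map_smul, LinearMap.smul_apply, zero_add]
    exact Submodule.smul_mem _ _ (hl s y hy)
  obtain _ | s := s
  · obtain ⟨a, rfl⟩ := Submodule.mem_span_singleton.1 hy
    rw [map_smul]
    exact Submodule.smul_mem _ _ (hr _ x hx)
  have mono {m n : ℕ} (h : m ≤ n) {z : H} (hz : z ∈ connFiltration Δ m) :
    z ∈ connFiltration Δ n := connFiltration_mono Δ h hz
  rw [show r + 1 + (s + 1) = (r + s + 1) + 1 by omega, mem_connFiltration_succ]
  have ex : Δ x = reducedComul Δ x + (1 ⊗ₜ x + x ⊗ₜ 1) := by rw [reducedComul_apply]; abel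
  have ey : Δ y = reducedComul Δ y + (1 ⊗ₜ y + y ⊗ₜ 1) := by rw [reducedComul_apply]; abel
  set T := TensorProduct.map₂ (LinearMap.mul k H) e + TensorProduct.map₂ e ε with hT
  -- These two terms are the ones subtracted in the reduced coproduct of `e x y`. All other terms
  -- must lie in `Fᵣ₊ₛ₊₁ ⊗ Fᵣ₊ₛ₊₁`.
  have t1 : T (1 ⊗ₜ x) (1 ⊗ₜ y) = 1 ⊗ₜ e x y := by simp [hT, h0]
  have t2 : T (x ⊗ₜ 1) (y ⊗ₜ 1) = e x y ⊗ₜ 1 := by simp [hT, h1]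
  have t3 : T (1 ⊗ₜ x) (y ⊗ₜ 1) ∈ connTensor Δ (r + s + 1) := by
    simp only [hT, LinearMap.add_apply, TensorProduct.map₂_apply_tmul, TensorProduct.map_tmul,
      LinearMap.mul_apply', one_mul]
    exact add_mem (tmul_mem_connTensor (mono (by omega) hy) (mono (by omega) (hr _ x hx)))
      (tmul_mem_connTensor (mono (by omega) (hl _ y hy)) (hε _ _ _))
  have t4 : T (x ⊗ₜ 1) (1 ⊗ₜ y) ∈ connTensor Δ (r + s + 1) := by
    simp only [hT, LinearMap.add_apply, TensorProduct.map₂_apply_tmul, TensorProduct.map_tmul,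
      LinearMap.mul_apply', mul_one]
    exact add_mem (tmul_mem_connTensor (mono (by omega) hx) (mono (by omega) (hl _ y hy)))
      (tmul_mem_connTensor (mono (by omega) (hr _ x hx)) (hε _ _ _))
  have o1 := one_mem_connFiltration Δ (r + 1)
  -- A reduced coproduct lowers its index by one, so in this term and the next the indices add up to
  -- `r + s + 1`, within reach of the induction.
  have t5 : T (1 ⊗ₜ x + x ⊗ₜ 1) (reducedComul Δ y) ∈ connTensor Δ (r + s + 1) :=
    mem_connTensor_of_add_le hε (by omega) (hm _ _ (by omega)) (ih _ _ (by omega))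
      (add_mem (tmul_mem_connTensor o1 hx) (tmul_mem_connTensor hx o1))
      ((mem_connFiltration_succ Δ).1 hy)
  have t6 : T (reducedComul Δ x) (Δ y) ∈ connTensor Δ (r + s + 1) :=
    mem_connTensor_of_add_le hε (by omega) (hm _ _ (by omega)) (ih _ _ (by omega))
      ((mem_connFiltration_succ Δ).1 hx) (comul_mem_connTensor hy)
  have key : reducedComul Δ (e x y) = T (reducedComul Δ x) (Δ y)
      + T (1 ⊗ₜ x + x ⊗ₜ 1) (reducedComul Δ y) + T (1 ⊗ₜ x) (y ⊗ₜ 1) + T (x ⊗ₜ 1) (1 ⊗ₜ y) := by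
    rw [reducedComul_apply, hΔ, ← t1, ← t2]
    nth_rw 1 [ex, map_add, LinearMap.add_apply]
    nth_rw 2 [ey]
    simp only [map_add, LinearMap.add_apply]
    abel
  rw [key]
  exact add_mem (add_mem (add_mem t6 t5) t3) t4

theorem mul_mem_connFiltration (r s : ℕ) : ∀ x ∈ connFiltration Δ r, ∀ y ∈ connFiltration Δ s,
    x * y ∈ connFiltration Δ (r + s) := by
  refine bilin_mem_connFiltration (e := LinearMap.mul k H) (ε := 0) (fun x y r => zero_mem _)
    (fun x y => ?_) (by simp) (by simp) (by simp) (by simp) (fun n h => h) r s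
  rw [LinearMap.mul_apply', map_mul]
  refine LinearMap.congr_fun₂ (f := LinearMap.mul k (H ⊗[k] H)) ?_ (Δ x) (Δ y)
  ext
  simp

end Connected

/-! ### The antipode of a connected bialgebra -/

section Antipode

open WithConv LinearMap

variable {k : Type u} {H : Type v} [Field k] [Ring H] [Bialgebra k H]

/-- The linear endomorphism `ηε - id` of a bialgebra, as an element of the convolution algebra. -/
noncomputable def convAug (k : Type u) (H : Type v) [Field k] [Ring H] [Bialgebra k H] :
    WithConv (H →ₗ[k] H) := 1 - toConv LinearMap.id

theorem convAug_one : convAug k H 1 = 0 := by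
  simp [convAug]

theorem convAug_pow_one {n : ℕ} (hn : n ≠ 0) : (convAug k H ^ n) 1 = 0 := by
  obtain ⟨n, rfl⟩ := Nat.exists_eq_succ_of_ne_zero hn
  rw [pow_succ', convMul_apply, Bialgebra.comul_one, Algebra.TensorProduct.one_def,
    TensorProduct.map_tmul]
  change mul' k H (convAug k H 1 ⊗ₜ _) = 0
  rw [convAug_one, TensorProduct.zero_tmul, map_zero]

/-- Write `g` for `convAug`, so that `gⁿ⁺¹ = μ (g ⊗ gⁿ) Δ`. The terms `1 ⊗ x` and `x ⊗ 1` die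
because `g` and `gⁿ` vanish at `1`, and on the reduced part the factor `gⁿ` vanishes by induction.
-/
theorem convAug_pow_eq_zero {n r : ℕ} (hn : r < n) :
    ∀ x ∈ connFiltration (Bialgebra.comulAlgHom k H) r, (convAug k H ^ n) x = 0 := by
  induction n generalizing r with
  | zero => omega
  | succ n ih =>
  intro x hx
  obtain _ | r := r
  · obtain ⟨a, rfl⟩ := Submodule.mem_span_singleton.1 hx
    change (convAug k H ^ (n + 1)).ofConv (a • 1) = 0
    rw [map_smul]
    exact (congrArg _ (convAug_pow_one (by omega))).trans (smul_zero a)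
  have h := (mem_connFiltration_succ _).1 hx
  have e : Coalgebra.comul (R := k) x
      = reducedComul (Bialgebra.comulAlgHom k H) x + 1 ⊗ₜ x + x ⊗ₜ 1 := by
    rw [reducedComul_apply, Bialgebra.comulAlgHom_apply]; abel
  rw [pow_succ', convMul_apply, e, map_add, map_add (TensorProduct.map _ _),
    TensorProduct.map_tmul, TensorProduct.map_tmul, map_add]
  have e1 : (convAug k H).ofConv 1 = 0 := convAug_one
  have e2 : (convAug k H ^ n).ofConv 1 = 0 := convAug_pow_one (by omega)
  rw [e1, e2, TensorProduct.zero_tmul, TensorProduct.tmul_zero, map_zero, add_zero, add_zero]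
  have e3 : connTensor (Bialgebra.comulAlgHom k H) r
      ≤ LinearMap.ker (TensorProduct.map (convAug k H).ofConv (convAug k H ^ n).ofConv) := by
    rw [connTensor_eq_map₂, Submodule.map₂_le]
    intro a ha b hb
    have e4 : (convAug k H ^ n).ofConv b = 0 := ih (by omega) b hb
    simp [e4]
  rw [LinearMap.mem_ker.1 (e3 h), map_zero]

/-- A connected bialgebra has an antipode. -/
theorem exists_antipode (hc : ∀ x, ∃ r, x ∈ connFiltration (Bialgebra.comulAlgHom k H) r) :
    ∃ S : WithConv (H →ₗ[k] H), S * toConv LinearMap.id = 1 ∧ toConv LinearMap.id * S = 1 := by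
  set g := convAug k H with hg
  set F := connFiltration (Bialgebra.comulAlgHom k H) with hF
  -- Partial sums of the geometric series for the convolution inverse of `id = 1 - g`.
  let s : ℕ → WithConv (H →ₗ[k] H) := fun n => ∑ i ∈ Finset.range n, g ^ i
  have stab {r N : ℕ} {x : H} (hx : x ∈ F r) (hN : r < N) : s N x = s (r + 1) x := by
    induction N, hN using Nat.le_induction with
    | base => rfl
    | succ N hN ih =>
      have e : s (N + 1) = s N + g ^ N := Finset.sum_range_succ _ _
      rw [e]
      change s N x + (g ^ N) x = _
      rw [convAug_pow_eq_zero hN x hx, add_zero, ih]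
  choose r hr using hc
  -- The stable value does not depend on the chosen `r x`; hence `S` below is linear.
  have key {n N : ℕ} {x : H} (hx : x ∈ F n) (hN : n < N) : s (r x + 1) x = s N x := by
    rw [stab hx hN, ← stab (hr x) (N := max (r x) n + 1) (by omega),
      stab hx (N := max (r x) n + 1) (by omega)]
  let S : H →ₗ[k] H :=
    { toFun := fun x => s (r x + 1) x
      map_add' := fun x y => by
        have hx : x ∈ F (max (r x) (r y)) := connFiltration_mono _ (le_max_left _ _) (hr x)
        have hy : y ∈ F (max (r x) (r y)) := connFiltration_mono _ (le_max_right _ _) (hr y)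
        rw [key (add_mem hx hy) (Nat.lt_succ_self _), key hx (Nat.lt_succ_self _),
          key hy (Nat.lt_succ_self _)]
        exact map_add (s _).ofConv x y
      map_smul' := fun a x => by
        rw [key (Submodule.smul_mem _ a (hr x)) (Nat.lt_succ_self _)]
        exact map_smul (s _).ofConv a x }
  have hS {n : ℕ} {x : H} (hx : x ∈ F n) : S x = (s (n + 1)).ofConv x := key hx (Nat.lt_succ_self n)
  have e1 : toConv LinearMap.id = 1 - g := by simp [hg, convAug]
  have hlt (x : H) : r x < r x + 1 := Nat.lt_succ_self _
  refine ⟨toConv S, ?_, ?_⟩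
  · ext x
    -- As `Δ x` lies in `Fᵣ ⊗ Fᵣ` for `r = r x`, the convolution at `x` sees `S` only on `Fᵣ`, where
    -- it is a single partial sum. The product then telescopes to `1 - gʳ⁺¹`, and `gʳ⁺¹` kills `x`.
    have h : connTensor (Bialgebra.comulAlgHom k H) (r x) ≤ LinearMap.eqLocus
        (TensorProduct.map S LinearMap.id)
        (TensorProduct.map (s (r x + 1)).ofConv LinearMap.id) := by
      rw [connTensor_eq_map₂, Submodule.map₂_le]
      intro a ha b hb
      simp [LinearMap.mem_eqLocus, hS ha]
    have h' : (toConv S * toConv LinearMap.id : WithConv (H →ₗ[k] H)) x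
        = (s (r x + 1) * toConv LinearMap.id : WithConv (H →ₗ[k] H)) x :=
      congrArg (mul' k H) (h (comul_mem_connTensor (hr x)))
    refine h'.trans ?_
    rw [e1, geom_sum_mul_neg]
    change (1 : WithConv (H →ₗ[k] H)) x - (g ^ (r x + 1)) x = _
    rw [convAug_pow_eq_zero (hlt x) x (hr x), sub_zero]
  · ext x
    have h : connTensor (Bialgebra.comulAlgHom k H) (r x) ≤ LinearMap.eqLocus
        (TensorProduct.map LinearMap.id S)
        (TensorProduct.map LinearMap.id (s (r x + 1)).ofConv) := by
      rw [connTensor_eq_map₂, Submodule.map₂_le]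
      intro a ha b hb
      simp [LinearMap.mem_eqLocus, hS hb]
    have h' : (toConv LinearMap.id * toConv S : WithConv (H →ₗ[k] H)) x
        = (toConv LinearMap.id * s (r x + 1) : WithConv (H →ₗ[k] H)) x :=
      congrArg (mul' k H) (h (comul_mem_connTensor (hr x)))
    refine h'.trans ?_
    rw [e1, mul_neg_geom_sum]
    change (1 : WithConv (H →ₗ[k] H)) x - (g ^ (r x + 1)) x = _
    rw [convAug_pow_eq_zero (hlt x) x (hr x), sub_zero]

end Antipode

theorem isHopf_of_isConnectedComul {k : Type u} {H : Type v} [Field k] [Ring H] [Algebra k H]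
    {Δ : H →ₐ[k] H ⊗[k] H} {ε : H →ₐ[k] k}
    (h₁ : (Algebra.TensorProduct.assoc k k k H H H).toAlgHom.comp
      ((Algebra.TensorProduct.map Δ (.id k H)).comp Δ)
      = (Algebra.TensorProduct.map (.id k H) Δ).comp Δ)
    (h₂ : (Algebra.TensorProduct.map ε (.id k H)).comp Δ = (Algebra.TensorProduct.lid k H).symm)
    (h₃ : (Algebra.TensorProduct.map (.id k H) ε).comp Δ = (Algebra.TensorProduct.rid k k H).symm)
    (hc : IsConnectedComul Δ) : IsHopf Δ ε := by
  refine ⟨h₁, h₂, h₃, ?_⟩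
  let B : Bialgebra k H := Bialgebra.ofAlgHom Δ ε h₁ h₂ h₃
  obtain ⟨S, hS, hS'⟩ := exists_antipode (k := k) (H := H) hc.2
  exact ⟨{ B with
    antipode := S.ofConv
    mul_antipode_rTensor_comul := congrArg WithConv.ofConv hS
    mul_antipode_lTensor_comul := congrArg WithConv.ofConv hS' }, rfl⟩

/-! ### The augmented free algebras -/

section Main

variable {k : Type u} {A : Type v} {V : Type w} [Field k] [AddCommGroup A] [Module k A]
  [AddCommGroup V] [Module k V] {o : DNOps k A} {i : V →ₗ[k] A}

/-- The general induction applies with `e(1, 1) = 0` and `u(1, 1) = 1`, the product being already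
known to respect the filtration. -/
theorem extOp_mem_connFiltration (h : IsDendNij o) {δ : A →ₗ[k] augTensor h h}
    (hδ : IsDNHom o (augTensorOps h h) δ) (c : DNOp) {r s : ℕ} {x y : Aug h}
    (hx : x ∈ connFiltration (comulOf h hδ) r) (hy : y ∈ connFiltration (comulOf h hδ) s) :
    extOp h c x y ∈ connFiltration (comulOf h hδ) (r + s) := by
  have one_mem (r : ℕ) (a : k) : a • (1 : Aug h) ∈ connFiltration (comulOf h hδ) r :=
    Submodule.smul_mem _ _ (one_mem_connFiltration _ r)
  refine bilin_mem_connFiltration (ε := unitPart h) (fun x y r => one_mem r _)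
    (comulOf_extOp h hδ c) (fun x y => ?_) (fun x y => ?_) (fun r x hx => ?_) (fun r x hx => ?_)
    (fun _ _ r s _ => mul_mem_connFiltration r s) r s x hx y hy
  · rw [extOp_one_one, TensorProduct.zero_tmul]
  · simp [extOp_one_one, unitPart_apply]
  · rw [extOp_one_left]
    exact Submodule.smul_mem _ _ (sub_mem hx (one_mem r _))
  · rw [extOp_one_right]
    exact Submodule.smul_mem _ _ (sub_mem hx (one_mem r _))

/-- The elements of `A` lying in some `Fᵣ` form a subspace stable under the operations, and it
contains `V` because primitive elements lie in `F₁`. -/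
theorem isConnectedComul_comulOf (h : IsDendNij o) {δ : A →ₗ[k] augTensor h h}
    (hδ : IsDNHom o (augTensorOps h h) δ) (hi : DNGenerates o i)
    (hv : ∀ v, (δ (i v) : Aug h ⊗[k] Aug h) = 1 ⊗ₜ Aug.incl h (i v) + Aug.incl h (i v) ⊗ₜ 1) :
    IsConnectedComul (comulOf h hδ) := by
  have mono := connFiltration_mono (comulOf h hδ)
  refine ⟨mono, fun x => ?_⟩
  have hp := hi ((⨆ r, connFiltration (comulOf h hδ) r).comap (Aug.incl h)) (fun v => ?_)
    fun c x hx y hy => ?_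
  · obtain ⟨a, hx⟩ := Aug.exists_eq_add h x
    have ha : a ∈ (⊤ : Submodule k A) := trivial
    rw [← hp, Submodule.mem_comap, Submodule.mem_iSup_of_directed _ mono.directed_le] at ha
    obtain ⟨r, hr⟩ := ha
    refine ⟨r, hx ▸ add_mem (Submodule.smul_mem _ _ (one_mem_connFiltration _ r)) hr⟩
  · rw [Submodule.mem_comap, Submodule.mem_iSup_of_directed _ mono.directed_le]
    refine ⟨1, (mem_connFiltration_succ _).2 ?_⟩
    rw [reducedComul_apply, comulOf_incl, hv, add_sub_cancel_left, sub_self]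
    exact zero_mem _
  · rw [Submodule.mem_comap, Submodule.mem_iSup_of_directed _ mono.directed_le] at hx hy ⊢
    obtain ⟨r, hr⟩ := hx
    obtain ⟨s, hs⟩ := hy
    exact ⟨r + s, extOp_incl_incl h c x y ▸ extOp_mem_connFiltration h hδ c hr hs⟩

theorem hasConnectedHopf_of_generates (h : IsDendNij o) (hi : DNGenerates o i)
    (he : ∀ f : V →ₗ[k] augTensor h h,
      ∃ g : A →ₗ[k] augTensor h h, IsDNHom o (augTensorOps h h) g ∧ g ∘ₗ i = f) :
    HasConnectedHopf h i := by
  let p : V →ₗ[k] Aug h ⊗[k] Aug h := (TensorProduct.mk k (Aug h) (Aug h) 1) ∘ₗ Aug.incl h ∘ₗ i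
    + ((TensorProduct.mk k (Aug h) (Aug h)).flip 1) ∘ₗ Aug.incl h ∘ₗ i
  obtain ⟨δ, hδ, hδi⟩ := he (p.codRestrict (augTensor h h) fun v =>
    add_mem (tmul_incl_mem h h _ _) (incl_tmul_one_mem h h _))
  have hv (v : V) : (δ (i v) : Aug h ⊗[k] Aug h)
      = 1 ⊗ₜ Aug.incl h (i v) + Aug.incl h (i v) ⊗ₜ 1 :=
    congrArg Subtype.val (LinearMap.congr_fun hδi v)
  have hc := isConnectedComul_comulOf h hδ hi hv
  exact ⟨comulOf h hδ, Aug.counit h,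
    isHopf_of_isConnectedComul (comulOf_coassoc h hδ hi hv) (comulOf_rTensor_counit h hδ hi hv)
      (comulOf_lTensor_counit h hδ hi hv) hc, hc, fun _ => rfl,
    fun v => (comulOf_incl h hδ _).trans (hv v),
    fun x => comulOf_incl h hδ x ▸ (δ x).2, comulOf_op h hδ⟩

/-! ### Free algebras are generated by `V` -/

/-- The operations of a subalgebra. -/
noncomputable def DNOps.restrict (o : DNOps k A) (p : Submodule k A)
    (hp : ∀ c, ∀ x ∈ p, ∀ y ∈ p, o c x y ∈ p) : DNOps k p := fun c =>
  LinearMap.mk₂ k (fun x y => ⟨o c x y, hp c x x.2 y y.2⟩)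
    (fun x x' y => by ext; simp) (fun r x y => by ext; simp)
    (fun x y y' => by ext; simp) (fun r x y => by ext; simp)

theorem IsDendNij.restrict (h : IsDendNij o) (p : Submodule k A)
    (hp : ∀ c, ∀ x ∈ p, ∀ y ∈ p, o c x y ∈ p) : IsDendNij (o.restrict p hp) := by
  refine isDendNij_iff.2 fun r hr x y z => Subtype.ext ?_
  have h := isDendNij_iff.1 h r hr x y z
  rw [DNOps.lhs_apply, DNOps.rhs_apply] at h ⊢
  simp only [← Submodule.subtype_apply, map_list_sum, List.map_map]
  exact h

/-- If subalgebras containing the generators admit a retraction, they are everything. -/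
theorem dnGenerates_of_lift
    (he : ∀ (p : Submodule k A) (hp : ∀ c, ∀ x ∈ p, ∀ y ∈ p, o c x y ∈ p) (f : V →ₗ[k] p),
      ∃ g : A →ₗ[k] p, IsDNHom o (o.restrict p hp) g ∧ g ∘ₗ i = f)
    (hu : ∀ g : A →ₗ[k] A, IsDNHom o o g → g ∘ₗ i = i → g = LinearMap.id) :
    DNGenerates o i := by
  intro p hv hp
  obtain ⟨g, hg, hgi⟩ := he p hp (i.codRestrict p hv)
  -- Followed by the inclusion of `p`, the lift `g` is an endomorphism fixing the generators, hence
  -- the identity; so every element lies in `p`.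
  have e := hu (p.subtype ∘ₗ g) (fun c x y => congrArg p.subtype (hg c x y))
    (by rw [LinearMap.comp_assoc, hgi]; rfl)
  refine eq_top_iff.2 fun x _ => ?_
  rw [show x = p.subtype (g x) from (LinearMap.congr_fun e x).symm]
  exact (g x).2

end Main

theorem IsFreeDN.dnGenerates {k : Type u} {V : Type v} {F : Type (max u v)} [Field k]
    [AddCommGroup V] [Module k V] [AddCommGroup F] [Module k F] {o : DNOps k F} {i : V →ₗ[k] F}
    (hF : IsFreeDN o i) : DNGenerates o i :=
  dnGenerates_of_lift
    (fun p hp f => (hF.existsUnique_lift p _ (hF.isDendNij.restrict p hp) f).exists)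
    fun _ hg hgi => (hF.existsUnique_lift F o hF.isDendNij i).unique ⟨hg, hgi⟩
      ⟨fun _ _ _ => rfl, rfl⟩

theorem IsFreeCommDN.dnGenerates {k : Type u} {V : Type v} {F : Type (max u v)} [Field k]
    [AddCommGroup V] [Module k V] [AddCommGroup F] [Module k F] {o : DNOps k F} {i : V →ₗ[k] F}
    (hF : IsFreeCommDN o i) : DNGenerates o i :=
  dnGenerates_of_lift
    (fun p hp f => (hF.existsUnique_lift p _ (hF.isDendNij.restrict p hp)
      (fun c x y => Subtype.ext (hF.isComm c x y)) f).exists)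
    fun _ hg hgi => (hF.existsUnique_lift F o hF.isDendNij hF.isComm i).unique ⟨hg, hgi⟩
      ⟨fun _ _ _ => rfl, rfl⟩

theorem mainTheorem9 :
    -- coherence of the unit action
    (∀ {k : Type u} {A : Type v} {B : Type w} [Field k] [CharZero k] [AddCommGroup A]
      [Module k A] [AddCommGroup B] [Module k B] {oA : DNOps k A} {oB : DNOps k B}
      (hA : IsDendNij oA) (hB : IsDendNij oB),
      ∃ o : DNOps k (augTensor hA hB),
        (∀ c x y, (o c x y : Aug hA ⊗[k] Aug hB) = tensorOp hA hB c x y) ∧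
        IsDendNij o ∧ (IsCommDN oA → IsCommDN oB → IsCommDN o)) ∧
    -- the augmented free dendriform-Nijenhuis algebra
    (∀ {k : Type u} {V : Type v} {F : Type (max u v)} [Field k] [CharZero k] [AddCommGroup V]
      [Module k V] [AddCommGroup F] [Module k F] {o : DNOps k F} {i : V →ₗ[k] F}
      (hF : IsFreeDN o i), HasConnectedHopf hF.isDendNij i) ∧
    -- the augmented free commutative dendriform-Nijenhuis algebra
    (∀ {k : Type u} {V : Type v} {F : Type (max u v)} [Field k] [CharZero k] [AddCommGroup V]
      [Module k V] [AddCommGroup F] [Module k F] {o : DNOps k F} {i : V →ₗ[k] F}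
      (hF : IsFreeCommDN o i), HasConnectedHopf hF.isDendNij i) := by

  refine ⟨fun hA hB => ⟨augTensorOps hA hB, coe_augTensorOps hA hB, isDendNij_augTensorOps hA hB,
    isCommDN_augTensorOps hA hB⟩, fun hF => ?_, fun hF => ?_⟩
  · exact hasConnectedHopf_of_generates hF.isDendNij hF.dnGenerates fun f =>
      (hF.existsUnique_lift _ _ (isDendNij_augTensorOps _ _) f).exists
  · exact hasConnectedHopf_of_generates hF.isDendNij hF.dnGenerates fun f =>
      (hF.existsUnique_lift _ _ (isDendNij_augTensorOps _ _)
        (isCommDN_augTensorOps _ _ hF.isComm hF.isComm) f).exists
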